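/- Throughout, $A,A',B,B',C,C',C''$ are complex $N\times N$ matrices, $I$ is the identity matrix, $r\ge 0$ is an integer and $x,y$ are complex variables. For an integer $n\ge 0$ put $(A)_n=A(A+I)\cdots(A+(n-1)I)$ (with $(A)_0=I$), $(A)_n^{-1}=((A)_n)^{-1}$, and, for $n\ge1$, $(A)_{-n}=(-1)^n(I-A)_n^{-1}$. For $z\in\mathbb{C}\setminus(-\infty,0]$ and a matrix $P$ let $z^P=\exp(P\log z)$ with the principal logarithm; $\partial_x,\partial_y$ are the partial derivatives. A coefficient family $c_{m,n}$ defines the matrix function $F(x,y)=\sum_{m,n\ge0}c_{m,n}\frac{x^my^n}{m!\,n!}$. The Horn matrix functions and their confluent forms $F$ are given by the following $c_{m,n}$: - $G_{2}(A,A',B,B';x,y)$: $c_{m,n}=(A)_{m}(A')_{n}(B)_{n-m}(B')_{m-n}$ - $G_{3}(A,A';x,y)$: $c_{m,n}=(A)_{2n-m}(A')_{2m-n}$ - $H_{1}(A,B,C,C';x,y)$: $c_{m,n}=(A)_{m-n}(B)_{m+n}(C)_{n}(C')_{m}^{-1}$ - $H_{2}(A,B,C,C',C'';x,y)$: $c_{m,n}=(A)_{m-n}(B)_{m}(C)_{n}(C')_{n}(C'')_{m}^{-1}$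 - $H_{3}(A,B,C;x,y)$: $c_{m,n}=(A)_{2m+n}(B)_{n}(C)_{m+n}^{-1}$ - $H_{4}(A,B,C,C';x,y)$: $c_{m,n}=(A)_{2m+n}(B)_{n}(C)_{m}^{-1}(C')_{n}^{-1}$ - $H_{5}(A,B,C;x,y)$: $c_{m,n}=(A)_{2m+n}(B)_{n-m}(C)_{n}^{-1}$ - $H_{6}(A,B,C;x,y)$: $c_{m,n}=(A)_{2m-n}(B)_{n-m}(C)_{n}$ - $H_{7}(A,B,C,C';x,y)$: $c_{m,n}=(A)_{2m-n}(B)_{n}(C)_{n}(C')_{m}^{-1}$ - $\Gamma_{1}(A,B,B';x,y)$: $c_{m,n}=(A)_{m}(B)_{n-m}(B')_{m-n}$ - $\Gamma_{2}(B,B';x,y)$: $c_{m,n}=(B)_{n-m}(B')_{m-n}$ - $\mathcal{H}_{1}(A,B,C;x,y)$: $c_{m,n}=(A)_{m-n}(B)_{m+n}(C)_{m}^{-1}$ - $\mathcal{H}_{2}(A,B,B',C;x,y)$: $c_{m,n}=(A)_{m-n}(B)_{m}(B')_{n}(C)_{m}^{-1}$ - $\mathcal{H}_{3}(A,B,C;x,y)$: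 $c_{m,n}=(A)_{m-n}(B)_{m}(C)_{m}^{-1}$ - $\mathcal{H}_{4}(A,B',C;x,y)$: $c_{m,n}=(A)_{m-n}(B')_{n}(C)_{m}^{-1}$ - $\mathcal{H}_{5}(A,C;x,y)$: $c_{m,n}=(A)_{m-n}(C)_{m}^{-1}$ - $\mathcal{H}_{6}(A,C;x,y)$: $c_{m,n}=(A)_{2m+n}(C)_{m+n}^{-1}$ - $\mathcal{H}_{7}(A,C,C';x,y)$: $c_{m,n}=(A)_{2m+n}(C)_{m}^{-1}(C')_{n}^{-1}$ - $\mathcal{H}_{8}(A,B;x,y)$: $c_{m,n}=(A)_{2m-n}(B)_{n-m}$ - $\mathcal{H}_{9}(A,B,C;x,y)$: $c_{m,n}=(A)_{2m-n}(B)_{n}(C)_{m}^{-1}$ - $\mathcal{H}_{10}(A,C;x,y)$: $c_{m,n}=(A)_{2m-n}(C)_{m}^{-1}$ - $\mathcal{H}_{11}(A,B,C,C';x,y)$: $c_{m,n}=(A)_{m-n}(B)_{n}(C)_{n}(C')_{m}^{-1}$ $F[P+rI,\dots]$ denotes $F$ with the parameter $P$ replaced by $P+rI$, and so on, the other parameters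 being unchanged. Such a function is said to be defined at a point $(x,y)$ if its coefficients are defined (that is, $P+kI$ is invertible for all integers $k\ge0$ for each $P$ that occurs as $(P)^{-1}_{\,\cdot}$, and $P-kI$ is invertible for all integers $k\ge1$ for each $P$ that occurs with an index containing a difference such as $m-n$, $n-m$, $2m-n$, $2n-m$), and $(x,y)$ lies in the region of absolute convergence, the interior of the set of points at which the double series converges absolutely. Then each formula below holds under the commutativity hypotheses listed with it (none if none are listed), at every point at which the two functions $F[\dots]$ on its two sides are defined and, if a matrix power $x^P$ or $y^P$ occurs, its base is in $\mathbb{C}\setminus(-\infty,0]$; moreover the function that is differentiated is analytic in the variable of differentiation there. **$G_{2}$:** 1. $\partial_x^r G_{2}(x, y)=(-1)^r\,(A)_r\,G_{2}[A+rI, B-rI, B'+rI](x, y)\,(I-B)_r^{-1}\,(B')_r$ if $BB'=B'B$ 2. $\partial_y^r G_{2}(x, y)=(-1)^r\,(A')_r\,G_{2}[A'+rI, B+rI, B'-rI](x, y)\,(B)_r\,(I-B')_r^{-1}$ if $AA'=A'A$, $BB'=B'B$ 3. $(x^2\partial_x)^r [x^{A}\,G_{2}(x, y)]=x^{A+rI}\,(A)_r\,G_{2}[A+rI](x,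 y)$ 4. $(y^2\partial_y)^r [y^{A'}\,G_{2}(x, y)]=y^{A'+rI}\,(A')_r\,G_{2}[A'+rI](x, y)$ if $AA'=A'A$ 5. $(x^2\partial_x)^r [G_{2}(x, y/x)\,x^{B'}]=G_{2}[B'+rI](x, y/x)\,x^{B'+rI}\,(B')_r$ 6. $(y^2\partial_y)^r [G_{2}(x/y, y)\,y^{B}]=G_{2}[B+rI](x/y, y)\,y^{B+rI}\,(B)_r$ if $BB'=B'B$ **$G_{3}$:** 1. $\partial_x^r G_{3}(x, y)=(-1)^r\,(I-A)_r^{-1}\,G_{3}[A-rI, A'+2rI](x, y)\,(A')_{2r}$ 2. $\partial_y^r G_{3}(x, y)=(-1)^r\,(A)_{2r}\,G_{3}[A+2rI, A'-rI](x, y)\,(I-A')_r^{-1}$ 3. $(x^2\partial_x)^r [G_{3}(x^2, y/x)\,x^{A'}]=G_{3}[A'+rI](x^2, y/x)\,x^{A'+rI}\,(A')_r$ 4. $(y^2\partial_y)^r [y^{A}\,G_{3}(x/y, y^2)]=y^{A+rI}\,(A)_r\,G_{3}[A+rI](x/y, y^2)$ **$H_{1}$:** 1. $\partial_x^r H_{1}(x,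 y)=(A)_r\,(B)_r\,H_{1}[A+rI, B+rI, C'+rI](x, y)\,(C')_r^{-1}$ if $AB=BA$ 2. $\partial_y^r H_{1}(x, y)=(-1)^r\,(I-A)_r^{-1}\,(B)_r\,H_{1}[A-rI, B+rI, C+rI](x, y)\,(C)_r$ if $AB=BA$, $CC'=C'C$ 3. $(x^2\partial_x)^r [x^{A}\,H_{1}(x, y/x)]=x^{A+rI}\,(A)_r\,H_{1}[A+rI](x, y/x)$ 4. $(x^2\partial_x)^r [x^{B}\,H_{1}(x, xy)]=x^{B+rI}\,(B)_r\,H_{1}[B+rI](x, xy)$ if $AB=BA$ 5. $(y^2\partial_y)^r [H_{1}(x, y)\,y^{C}]=H_{1}[C+rI](x, y)\,y^{C+rI}\,(C)_r$ if $CC'=C'C$ 6. $\partial_x^r [H_{1}(x, y)\,x^{C'-I}]=(-1)^r\,H_{1}[C'-rI](x, y)\,(I-C')_r\,x^{C'-(r+1)I}$ **$H_{2}$:** 1. $\partial_x^r H_{2}(x, y)=(A)_r\,(B)_r\,H_{2}[A+rI, B+rI, C''+rI](x, y)\,(C'')_r^{-1}$ if $AB=BA$ 2. $\partial_y^r H_{2}(x,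 y)=(-1)^r\,(I-A)_r^{-1}\,H_{2}[A-rI, C+rI, C'+rI](x, y)\,(C)_r\,(C')_r$ if $CC'=C'C$, $CC''=C''C$, $C'C''=C''C'$ 3. $(x^2\partial_x)^r [x^{A}\,H_{2}(x, y/x)]=x^{A+rI}\,(A)_r\,H_{2}[A+rI](x, y/x)$ 4. $(x^2\partial_x)^r [x^{B}\,H_{2}(x, y)]=x^{B+rI}\,(B)_r\,H_{2}[B+rI](x, y)$ if $AB=BA$ 5. $(y^2\partial_y)^r [H_{2}(x, y)\,y^{C}]=H_{2}[C+rI](x, y)\,y^{C+rI}\,(C)_r$ if $CC'=C'C$, $CC''=C''C$ 6. $\partial_x^r [H_{2}(x, y)\,x^{C''-I}]=(-1)^r\,H_{2}[C''-rI](x, y)\,(I-C'')_r\,x^{C''-(r+1)I}$ **$H_{3}$:** 1. $\partial_x^r H_{3}(x, y)=(A)_{2r}\,H_{3}[A+2rI, C+rI](x, y)\,(C)_r^{-1}$ 2. $\partial_y^r H_{3}(x, y)=(A)_r\,H_{3}[A+rI, B+rI, C+rI](x, y)\,(B)_r\,(C)_r^{-1}$ if $BC=CB$ 3. $(x^2\partial_x)^r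 [x^{A}\,H_{3}(x^2, xy)]=x^{A+rI}\,(A)_r\,H_{3}[A+rI](x^2, xy)$ 4. $(y^2\partial_y)^r [H_{3}(x, y)\,y^{B}]=H_{3}[B+rI](x, y)\,y^{B+rI}\,(B)_r$ if $BC=CB$ 5. $\partial_x^r [H_{3}(x, xy)\,x^{C-I}]=(-1)^r\,H_{3}[C-rI](x, xy)\,x^{C-(r+1)I}\,(I-C)_r$ **$H_{4}$:** 1. $\partial_x^r H_{4}(x, y)=(A)_{2r}\,H_{4}[A+2rI, C+rI](x, y)\,(C)_r^{-1}$ if $CC'=C'C$ 2. $\partial_y^r H_{4}(x, y)=(A)_r\,(B)_r\,H_{4}[A+rI, B+rI, C'+rI](x, y)\,(C')_r^{-1}$ if $AB=BA$ 3. $(x^2\partial_x)^r [x^{A}\,H_{4}(x^2, xy)]=x^{A+rI}\,(A)_r\,H_{4}[A+rI](x^2, xy)$ 4. $(y^2\partial_y)^r [y^{B}\,H_{4}(x, y)]=y^{B+rI}\,(B)_r\,H_{4}[B+rI](x, y)$ if $AB=BA$ 5. $\partial_x^r [H_{4}(x, y)\,x^{C-I}]=(-1)^r\,H_{4}[C-rI](x,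 y)\,x^{C-(r+1)I}\,(I-C)_r$ if $CC'=C'C$ 6. $\partial_y^r [H_{4}(x, y)\,y^{C'-I}]=(-1)^r\,H_{4}[C'-rI](x, y)\,y^{C'-(r+1)I}\,(I-C')_r$ **$H_{5}$:** 1. $\partial_x^r H_{5}(x, y)=(-1)^r\,(A)_{2r}\,(I-B)_r^{-1}\,H_{5}[A+2rI, B-rI](x, y)$ if $AB=BA$ 2. $\partial_y^r H_{5}(x, y)=(A)_r\,(B)_r\,H_{5}[A+rI, B+rI, C+rI](x, y)\,(C)_r^{-1}$ if $AB=BA$ 3. $(x^2\partial_x)^r [x^{A}\,H_{5}(x^2, xy)]=x^{A+rI}\,(A)_r\,H_{5}[A+rI](x^2, xy)$ 4. $(y^2\partial_y)^r [y^{B}\,H_{5}(x/y, y)]=y^{B+rI}\,(B)_r\,H_{5}[B+rI](x/y, y)$ if $AB=BA$ 5. $\partial_y^r [H_{5}(x, y)\,y^{C-I}]=(-1)^r\,H_{5}[C-rI](x, y)\,y^{C-(r+1)I}\,(I-C)_r$ **$H_{6}$:** 1. $\partial_x^r H_{6}(x, y)=(-1)^r\,(A)_{2r}\,(I-B)_r^{-1}\,H_{6}[A+2rI,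 B-rI](x, y)$ if $AB=BA$ 2. $\partial_y^r H_{6}(x, y)=(-1)^r\,(I-A)_r^{-1}\,(B)_r\,H_{6}[A-rI, B+rI, C+rI](x, y)\,(C)_r$ if $AB=BA$ 3. $(x^2\partial_x)^r [x^{A}\,H_{6}(x^2, y/x)]=x^{A+rI}\,(A)_r\,H_{6}[A+rI](x^2, y/x)$ 4. $(y^2\partial_y)^r [y^{B}\,H_{6}(x/y, y)]=y^{B+rI}\,(B)_r\,H_{6}[B+rI](x/y, y)$ if $AB=BA$ 5. $(y^2\partial_y)^r [H_{6}(x, y)\,y^{C}]=H_{6}[C+rI](x, y)\,y^{C+rI}\,(C)_r$ **$H_{7}$:** 1. $\partial_x^r H_{7}(x, y)=(A)_{2r}\,H_{7}[A+2rI, C'+rI](x, y)\,(C')_r^{-1}$ 2. $\partial_y^r H_{7}(x, y)=(-1)^r\,(I-A)_r^{-1}\,(B)_r\,H_{7}[A-rI, B+rI, C+rI](x, y)\,(C)_r$ if $AB=BA$, $CC'=C'C$ 3. $(x^2\partial_x)^r [x^{A}\,H_{7}(x^2, y/x)]=x^{A+rI}\,(A)_r\,H_{7}[A+rI](x^2,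 y/x)$ 4. $(y^2\partial_y)^r [y^{B}\,H_{7}(x, y)]=y^{B+rI}\,(B)_r\,H_{7}[B+rI](x, y)$ if $AB=BA$ 5. $(y^2\partial_y)^r [H_{7}(x, y)\,y^{C}]=H_{7}[C+rI](x, y)\,y^{C+rI}\,(C)_r$ if $CC'=C'C$ 6. $\partial_x^r [H_{7}(x, y)\,x^{C'-I}]=(-1)^r\,H_{7}[C'-rI](x, y)\,x^{C'-(r+1)I}\,(I-C')_r$ **$\Gamma_{1}$:** 1. $\partial_x^r \Gamma_{1}(x, y)=(-1)^r\,(A)_r\,\Gamma_{1}[A+rI, B-rI, B'+rI](x, y)\,(I-B)_r^{-1}\,(B')_r$ if $BB'=B'B$ 2. $\partial_y^r \Gamma_{1}(x, y)=(-1)^r\,\Gamma_{1}[B+rI, B'-rI](x, y)\,(B)_r\,(I-B')_r^{-1}$ if $BB'=B'B$ 3. $(x^2\partial_x)^r [x^{A}\,\Gamma_{1}(x, y)]=x^{A+rI}\,(A)_r\,\Gamma_{1}[A+rI](x, y)$ 4. $(x^2\partial_x)^r [\Gamma_{1}(x, y/x)\,x^{B'}]=\Gamma_{1}[B'+rI](x,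 y/x)\,x^{B'+rI}\,(B')_r$ 5. $(y^2\partial_y)^r [\Gamma_{1}(x/y, y)\,y^{B}]=\Gamma_{1}[B+rI](x/y, y)\,y^{B+rI}\,(B)_r$ if $BB'=B'B$ **$\Gamma_{2}$:** 1. $\partial_x^r \Gamma_{2}(x, y)=(-1)^r\,(I-B)_r^{-1}\,\Gamma_{2}[B-rI, B'+rI](x, y)\,(B')_r$ 2. $\partial_y^r \Gamma_{2}(x, y)=(-1)^r\,(B)_r\,\Gamma_{2}[B+rI, B'-rI](x, y)\,(I-B')_r^{-1}$ 3. $(x^2\partial_x)^r [\Gamma_{2}(x, y/x)\,x^{B'}]=\Gamma_{2}[B'+rI](x, y/x)\,x^{B'+rI}\,(B')_r$ 4. $(y^2\partial_y)^r [y^{B}\,\Gamma_{2}(x/y, y)]=y^{B+rI}\,(B)_r\,\Gamma_{2}[B+rI](x/y, y)$ 5. $(y^2\partial_y)^r [\Gamma_{2}(x/y, y)\,y^{B}]=\Gamma_{2}[B+rI](x/y, y)\,y^{B+rI}\,(B)_r$ if $BB'=B'B$ **$\mathcal{H}_{1}$:** 1. $\partial_x^r \mathcal{H}_{1}(x, y)=(A)_r\,(B)_r\,\mathcal{H}_{1}[A+rI,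 B+rI, C+rI](x, y)\,(C)_r^{-1}$ if $AB=BA$ 2. $\partial_y^r \mathcal{H}_{1}(x, y)=(-1)^r\,(I-A)_r^{-1}\,(B)_r\,\mathcal{H}_{1}[A-rI, B+rI](x, y)$ if $AB=BA$ 3. $(x^2\partial_x)^r [x^{A}\,\mathcal{H}_{1}(x, y/x)]=x^{A+rI}\,(A)_r\,\mathcal{H}_{1}[A+rI](x, y/x)$ 4. $(x^2\partial_x)^r [x^{B}\,\mathcal{H}_{1}(x, xy)]=x^{B+rI}\,(B)_r\,\mathcal{H}_{1}[B+rI](x, xy)$ if $AB=BA$ 5. $\partial_x^r [\mathcal{H}_{1}(x, y)\,x^{C-I}]=(-1)^r\,\mathcal{H}_{1}[C-rI](x, y)\,x^{C-(r+1)I}\,(I-C)_r$ **$\mathcal{H}_{2}$:** 1. $\partial_x^r \mathcal{H}_{2}(x, y)=(A)_r\,(B)_r\,\mathcal{H}_{2}[A+rI, B+rI, C+rI](x, y)\,(C)_r^{-1}$ if $AB=BA$ 2. $\partial_y^r \mathcal{H}_{2}(x, y)=(-1)^r\,(I-A)_r^{-1}\,\mathcal{H}_{2}[A-rI, B'+rI](x,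 y)\,(B')_r$ if $B'C=CB'$ 3. $(x^2\partial_x)^r [x^{A}\,\mathcal{H}_{2}(x, y/x)]=x^{A+rI}\,(A)_r\,\mathcal{H}_{2}[A+rI](x, y/x)$ 4. $(x^2\partial_x)^r [x^{B}\,\mathcal{H}_{2}(x, y)]=x^{B+rI}\,(B)_r\,\mathcal{H}_{2}[B+rI](x, y)$ if $AB=BA$ 5. $(y^2\partial_y)^r [\mathcal{H}_{2}(x, y)\,y^{B'}]=\mathcal{H}_{2}[B'+rI](x, y)\,y^{B'+rI}\,(B')_r$ if $B'C=CB'$ 6. $\partial_x^r [\mathcal{H}_{2}(x, y)\,x^{C-I}]=(-1)^r\,\mathcal{H}_{2}[C-rI](x, y)\,x^{C-(r+1)I}\,(I-C)_r$ **$\mathcal{H}_{3}$:** 1. $\partial_x^r \mathcal{H}_{3}(x, y)=(A)_r\,\mathcal{H}_{3}[A+rI, B+rI, C+rI](x, y)\,(B)_r\,(C)_r^{-1}$ if $BC=CB$ 2. $\partial_y^r \mathcal{H}_{3}(x, y)=(-1)^r\,(I-A)_r^{-1}\,\mathcal{H}_{3}[A-rI](x, y)$ 3. $(x^2\partial_x)^r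 [x^{A}\,\mathcal{H}_{3}(x, y/x)]=x^{A+rI}\,(A)_r\,\mathcal{H}_{3}[A+rI](x, y/x)$ 4. $(x^2\partial_x)^r [\mathcal{H}_{3}(x, y)\,x^{B}]=\mathcal{H}_{3}[B+rI](x, y)\,x^{B+rI}\,(B)_r$ if $BC=CB$ 5. $\partial_x^r [\mathcal{H}_{3}(x, y)\,x^{C-I}]=(-1)^r\,\mathcal{H}_{3}[C-rI](x, y)\,x^{C-(r+1)I}\,(I-C)_r$ **$\mathcal{H}_{4}$:** 1. $\partial_x^r \mathcal{H}_{4}(x, y)=(A)_r\,\mathcal{H}_{4}[A+rI, C+rI](x, y)\,(C)_r^{-1}$ 2. $\partial_y^r \mathcal{H}_{4}(x, y)=(-1)^r\,(I-A)_r^{-1}\,\mathcal{H}_{4}[A-rI, B'+rI](x, y)\,(B')_r$ if $B'C=CB'$ 3. $(x^2\partial_x)^r [x^{A}\,\mathcal{H}_{4}(x, y/x)]=x^{A+rI}\,(A)_r\,\mathcal{H}_{4}[A+rI](x, y/x)$ 4. $(y^2\partial_y)^r [\mathcal{H}_{4}(x, y)\,y^{B'}]=\mathcal{H}_{4}[B'+rI](x,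 y)\,y^{B'+rI}\,(B')_r$ if $B'C=CB'$ 5. $\partial_x^r [\mathcal{H}_{4}(x, y)\,x^{C-I}]=(-1)^r\,\mathcal{H}_{4}[C-rI](x, y)\,x^{C-(r+1)I}\,(I-C)_r$ **$\mathcal{H}_{5}$:** 1. $\partial_x^r \mathcal{H}_{5}(x, y)=(A)_r\,\mathcal{H}_{5}[A+rI, C+rI](x, y)\,(C)_r^{-1}$ 2. $\partial_y^r \mathcal{H}_{5}(x, y)=(-1)^r\,(I-A)_r^{-1}\,\mathcal{H}_{5}[A-rI](x, y)$ 3. $(x^2\partial_x)^r [x^{A}\,\mathcal{H}_{5}(x, y/x)]=x^{A+rI}\,(A)_r\,\mathcal{H}_{5}[A+rI](x, y/x)$ 4. $\partial_x^r [\mathcal{H}_{5}(x, y)\,x^{C-I}]=(-1)^r\,\mathcal{H}_{5}[C-rI](x, y)\,x^{C-(r+1)I}\,(I-C)_r$ **$\mathcal{H}_{6}$:** 1. $\partial_x^r \mathcal{H}_{6}(x, y)=(A)_{2r}\,\mathcal{H}_{6}[A+2rI, C+rI](x, y)\,(C)_r^{-1}$ 2. $\partial_y^r \mathcal{H}_{6}(x,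 y)=(A)_r\,\mathcal{H}_{6}[A+rI, C+rI](x, y)\,(C)_r^{-1}$ 3. $(x^2\partial_x)^r [x^{A}\,\mathcal{H}_{6}(x^2, xy)]=x^{A+rI}\,(A)_r\,\mathcal{H}_{6}[A+rI](x^2, xy)$ 4. $\partial_x^r [\mathcal{H}_{6}(x, xy)\,x^{C-I}]=(-1)^r\,\mathcal{H}_{6}[C-rI](x, xy)\,x^{C-(r+1)I}\,(I-C)_r$ **$\mathcal{H}_{7}$:** 1. $\partial_x^r \mathcal{H}_{7}(x, y)=(A)_{2r}\,\mathcal{H}_{7}[A+2rI, C+rI](x, y)\,(C)_r^{-1}$ if $CC'=C'C$ 2. $\partial_y^r \mathcal{H}_{7}(x, y)=(A)_r\,\mathcal{H}_{7}[A+rI, C'+rI](x, y)\,(C')_r^{-1}$ 3. $(x^2\partial_x)^r [x^{A}\,\mathcal{H}_{7}(x^2, xy)]=x^{A+rI}\,(A)_r\,\mathcal{H}_{7}[A+rI](x^2, xy)$ 4. $\partial_x^r [\mathcal{H}_{7}(x, y)\,x^{C-I}]=(-1)^r\,\mathcal{H}_{7}[C-rI](x, y)\,x^{C-(r+1)I}\,(I-C)_r$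 if $CC'=C'C$ 5. $\partial_y^r [\mathcal{H}_{7}(x, y)\,y^{C'-I}]=(-1)^r\,\mathcal{H}_{7}[C'-rI](x, y)\,y^{C'-(r+1)I}\,(I-C')_r$ **$\mathcal{H}_{8}$:** 1. $\partial_x^r \mathcal{H}_{8}(x, y)=(-1)^r\,(A)_{2r}\,\mathcal{H}_{8}[A+2rI, B-rI](x, y)\,(I-B)_r^{-1}$ 2. $\partial_y^r \mathcal{H}_{8}(x, y)=(-1)^r\,(I-A)_r^{-1}\,\mathcal{H}_{8}[A-rI, B+rI](x, y)\,(B)_r$ 3. $(x^2\partial_x)^r [x^{A}\,\mathcal{H}_{8}(x^2, y/x)]=x^{A+rI}\,(A)_r\,\mathcal{H}_{8}[A+rI](x^2, y/x)$ 4. $(y^2\partial_y)^r [\mathcal{H}_{8}(x/y, y)\,y^{B}]=\mathcal{H}_{8}[B+rI](x/y, y)\,y^{B+rI}\,(B)_r$ **$\mathcal{H}_{9}$:** 1. $\partial_x^r \mathcal{H}_{9}(x, y)=(A)_{2r}\,\mathcal{H}_{9}[A+2rI, C+rI](x, y)\,(C)_r^{-1}$ 2. $\partial_y^r \mathcal{H}_{9}(x,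 y)=(-1)^r\,(I-A)_r^{-1}\,\mathcal{H}_{9}[A-rI, B+rI](x, y)\,(B)_r$ if $BC=CB$ 3. $(x^2\partial_x)^r [x^{A}\,\mathcal{H}_{9}(x^2, y/x)]=x^{A+rI}\,(A)_r\,\mathcal{H}_{9}[A+rI](x^2, y/x)$ 4. $(y^2\partial_y)^r [\mathcal{H}_{9}(x, y)\,y^{B}]=\mathcal{H}_{9}[B+rI](x, y)\,y^{B+rI}\,(B)_r$ if $BC=CB$ 5. $\partial_x^r [\mathcal{H}_{9}(x, y)\,x^{C-I}]=(-1)^r\,\mathcal{H}_{9}[C-rI](x, y)\,x^{C-(r+1)I}\,(I-C)_r$ **$\mathcal{H}_{10}$:** 1. $\partial_x^r \mathcal{H}_{10}(x, y)=(A)_{2r}\,\mathcal{H}_{10}[A+2rI, C+rI](x, y)\,(C)_r^{-1}$ 2. $\partial_y^r \mathcal{H}_{10}(x, y)=(-1)^r\,(I-A)_r^{-1}\,\mathcal{H}_{10}[A-rI](x, y)$ 3. $(x^2\partial_x)^r [x^{A}\,\mathcal{H}_{10}(x^2, y/x)]=x^{A+rI}\,(A)_r\,\mathcal{H}_{10}[A+rI](x^2,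 y/x)$ 4. $\partial_x^r [\mathcal{H}_{10}(x, y)\,x^{C-I}]=(-1)^r\,\mathcal{H}_{10}[C-rI](x, y)\,x^{C-(r+1)I}\,(I-C)_r$ **$\mathcal{H}_{11}$:** 1. $\partial_x^r \mathcal{H}_{11}(x, y)=(A)_r\,\mathcal{H}_{11}[A+rI, C'+rI](x, y)\,(C')_r^{-1}$ 2. $\partial_y^r \mathcal{H}_{11}(x, y)=(-1)^r\,(I-A)_r^{-1}\,(B)_r\,\mathcal{H}_{11}[A-rI, B+rI, C+rI](x, y)\,(C)_r$ if $AB=BA$, $CC'=C'C$ 3. $(x^2\partial_x)^r [x^{A}\,\mathcal{H}_{11}(x, y/x)]=x^{A+rI}\,(A)_r\,\mathcal{H}_{11}[A+rI](x, y/x)$ 4. $(y^2\partial_y)^r [y^{B}\,\mathcal{H}_{11}(x, y)]=y^{B+rI}\,(B)_r\,\mathcal{H}_{11}[B+rI](x, y)$ if $AB=BA$ 5. $\partial_x^r [\mathcal{H}_{11}(x, y)\,x^{C'-I}]=(-1)^r\,\mathcal{H}_{11}[C'-rI](x, y)\,x^{C'-(r+1)I}\,(I-C')_r$ -/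

import Mathlib

open scoped Matrix.Norms.L2Operator

namespace HornMatrix

/-- Square complex matrices of size `N`, with the operator norm induced by the Euclidean norm. -/
abbrev Mat (N : ℕ) := Matrix (Fin N) (Fin N) ℂ

/-- The Pochhammer symbol with integer index: `(A)_n = A (A + I) ⋯ (A + (n - 1) I)` for `n ≥ 0` and
`(A)_{-n} = (-1)^n ((I - A)_n)⁻¹` for `n ≥ 1`. -/
noncomputable def poch {N : ℕ} (A : Mat N) : ℤ → Mat N
  | Int.ofNat n => Polynomial.aeval A (ascPochhammer ℂ n)
  | Int.negSucc n => (-1) ^ (n + 1) * (Polynomial.aeval (1 - A) (ascPochhammer ℂ (n + 1)))⁻¹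

/-- `C + k I` is invertible for every integer `k ≥ 0`: all the symbols `(C)_n`, `n ≥ 0`, are
invertible. -/
def PosReg {N : ℕ} (C : Mat N) : Prop := ∀ k : ℕ, IsUnit (C + k • 1)

/-- `A - k I` is invertible for every integer `k ≥ 1`: all the symbols `(A)_{-n}`, `n ≥ 0`, are
defined. -/
def NegReg {N : ℕ} (A : Mat N) : Prop := ∀ k : ℕ, IsUnit (A - (k + 1) • 1)

/-- The matrix power `z ^ P = exp (P log z)`, with the principal branch of the logarithm. -/
noncomputable def mpow {N : ℕ} (z : ℂ) (P : Mat N) : Mat N :=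
  NormedSpace.exp (Complex.log z • P)

/-- The data of a double series `∑ c m n x^m y^n / (m! n!)`: its matrix coefficients `c m n`, and the
condition on the parameters under which all of them are defined. -/
structure Series (N : ℕ) where
  coeff : ℕ → ℕ → Mat N
  regular : Prop

/-- The term of index `k = (m, n)` of the double series at the point `p = (x, y)`. -/
noncomputable def Series.term {N : ℕ} (S : Series N) (p : ℂ × ℂ) (k : ℕ × ℕ) : Mat N :=
  (p.1 ^ k.1 * p.2 ^ k.2 / (k.1.factorial * k.2.factorial : ℂ)) • S.coeff k.1 k.2

/-- The sum of the double series. -/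
noncomputable def Series.eval {N : ℕ} (S : Series N) (p : ℂ × ℂ) : Mat N :=
  ∑' k : ℕ × ℕ, S.term p k

noncomputable instance {N : ℕ} : CoeFun (Series N) fun _ => ℂ × ℂ → Mat N := ⟨Series.eval⟩

/-- The domain of the matrix function: it is empty if some coefficient is undefined, and else it is
the region of absolute convergence, that is, the interior of the set of points at which the double
series converges absolutely. -/
def Series.dom {N : ℕ} (S : Series N) : Set (ℂ × ℂ) :=
  {p | S.regular ∧ p ∈ interior {q : ℂ × ℂ | Summable fun k => ‖S.term q k‖}}

/-- The operator `z² d/dz`. -/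
noncomputable def sqDeriv {N : ℕ} (f : ℂ → Mat N) : ℂ → Mat N := fun z => z ^ 2 • deriv f z

/-- `f` is analytic at `z`, and the `r`-th iterate of the operator `D`, applied to `f`, takes the
value `v` at `z`. -/
def IteratesTo {N : ℕ} (D : (ℂ → Mat N) → ℂ → Mat N) (r : ℕ) (f : ℂ → Mat N) (z : ℂ) (v : Mat N) :
    Prop :=
  AnalyticAt ℂ f z ∧ D^[r] f z = v

/-- `∂^r/∂x^r S(x, y) = L T(x, y) R` wherever both sides are defined. -/
def DiffX {N : ℕ} (r : ℕ) (S : Series N) (L : Mat N) (T : Series N) (R : Mat N) : Prop :=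
  ∀ x y : ℂ, (x, y) ∈ S.dom ∩ T.dom →
    IteratesTo deriv r (fun z => S (z, y)) x (L * T (x, y) * R)

/-- `∂^r/∂y^r S(x, y) = L T(x, y) R` wherever both sides are defined. -/
def DiffY {N : ℕ} (r : ℕ) (S : Series N) (L : Mat N) (T : Series N) (R : Mat N) : Prop :=
  ∀ x y : ℂ, (x, y) ∈ S.dom ∩ T.dom →
    IteratesTo deriv r (fun z => S (x, z)) y (L * T (x, y) * R)

/-- `(z² d/dz)^r [z^P S(γ(z))] = z^(P + r I) (P)_r T(γ(z))` wherever both sides are defined. -/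
def PowLeft {N : ℕ} (r : ℕ) (P : Mat N) (S T : Series N) (γ : ℂ → ℂ × ℂ) : Prop :=
  ∀ z ∈ Complex.slitPlane, γ z ∈ S.dom ∩ T.dom →
    IteratesTo sqDeriv r (fun z => mpow z P * S (γ z)) z
      (mpow z (P + r • 1) * poch P r * T (γ z))

/-- `(z² d/dz)^r [S(γ(z)) z^P] = T(γ(z)) z^(P + r I) (P)_r` wherever both sides are defined. -/
def PowRight {N : ℕ} (r : ℕ) (P : Mat N) (S T : Series N) (γ : ℂ → ℂ × ℂ) : Prop :=
  ∀ z ∈ Complex.slitPlane, γ z ∈ S.dom ∩ T.dom →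
    IteratesTo sqDeriv r (fun z => S (γ z) * mpow z P) z
      (T (γ z) * mpow z (P + r • 1) * poch P r)

/-- `d^r/dz^r [S(γ(z)) z^(C - I)] = (-1)^r T(γ(z)) z^(C - (r + 1) I) (I - C)_r` wherever both sides
are defined. -/
def PowLower {N : ℕ} (r : ℕ) (C : Mat N) (S T : Series N) (γ : ℂ → ℂ × ℂ) : Prop :=
  ∀ z ∈ Complex.slitPlane, γ z ∈ S.dom ∩ T.dom →
    IteratesTo deriv r (fun z => S (γ z) * mpow z (C - 1)) z
      ((-1) ^ r * T (γ z) * mpow z (C - (r + 1) • 1) * poch (1 - C) r)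

/-- The Horn function `G₂`. -/
noncomputable def G2 {N : ℕ} (A A' B B' : Mat N) : Series N where
  coeff m n := poch A m * poch A' n * poch B (n - m) * poch B' (m - n)
  regular := NegReg B ∧ NegReg B'

/-- The Horn function `G₃`. -/
noncomputable def G3 {N : ℕ} (A A' : Mat N) : Series N where
  coeff m n := poch A (2 * n - m) * poch A' (2 * m - n)
  regular := NegReg A ∧ NegReg A'

/-- The Horn function `H₁`. -/
noncomputable def H1 {N : ℕ} (A B C C' : Mat N) : Series N where
  coeff m n := poch A (m - n) * poch B (m + n) * poch C n * (poch C' m)⁻¹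
  regular := NegReg A ∧ PosReg C'

/-- The Horn function `H₂`. -/
noncomputable def H2 {N : ℕ} (A B C C' C'' : Mat N) : Series N where
  coeff m n := poch A (m - n) * poch B m * poch C n * poch C' n * (poch C'' m)⁻¹
  regular := NegReg A ∧ PosReg C''

/-- The Horn function `H₃`. -/
noncomputable def H3 {N : ℕ} (A B C : Mat N) : Series N where
  coeff m n := poch A (2 * m + n) * poch B n * (poch C (m + n))⁻¹
  regular := PosReg C

/-- The Horn function `H₄`. -/
noncomputable def H4 {N : ℕ} (A B C C' : Mat N) : Series N where
  coeff m n := poch A (2 * m + n) * poch B n * (poch C m)⁻¹ * (poch C' n)⁻¹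
  regular := PosReg C ∧ PosReg C'

/-- The Horn function `H₅`. -/
noncomputable def H5 {N : ℕ} (A B C : Mat N) : Series N where
  coeff m n := poch A (2 * m + n) * poch B (n - m) * (poch C n)⁻¹
  regular := NegReg B ∧ PosReg C

/-- The Horn function `H₆`. -/
noncomputable def H6 {N : ℕ} (A B C : Mat N) : Series N where
  coeff m n := poch A (2 * m - n) * poch B (n - m) * poch C n
  regular := NegReg A ∧ NegReg B

/-- The Horn function `H₇`. -/
noncomputable def H7 {N : ℕ} (A B C C' : Mat N) : Series N where
  coeff m n := poch A (2 * m - n) * poch B n * poch C n * (poch C' m)⁻¹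
  regular := NegReg A ∧ PosReg C'

/-- The confluent function `Γ₁`. -/
noncomputable def Γ1 {N : ℕ} (A B B' : Mat N) : Series N where
  coeff m n := poch A m * poch B (n - m) * poch B' (m - n)
  regular := NegReg B ∧ NegReg B'

/-- The confluent function `Γ₂`. -/
noncomputable def Γ2 {N : ℕ} (B B' : Mat N) : Series N where
  coeff m n := poch B (n - m) * poch B' (m - n)
  regular := NegReg B ∧ NegReg B'

/-- The confluent function `ℋ₁`. -/
noncomputable def ℋ1 {N : ℕ} (A B C : Mat N) : Series N where
  coeff m n := poch A (m - n) * poch B (m + n) * (poch C m)⁻¹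
  regular := NegReg A ∧ PosReg C

/-- The confluent function `ℋ₂`. -/
noncomputable def ℋ2 {N : ℕ} (A B B' C : Mat N) : Series N where
  coeff m n := poch A (m - n) * poch B m * poch B' n * (poch C m)⁻¹
  regular := NegReg A ∧ PosReg C

/-- The confluent function `ℋ₃`. -/
noncomputable def ℋ3 {N : ℕ} (A B C : Mat N) : Series N where
  coeff m n := poch A (m - n) * poch B m * (poch C m)⁻¹
  regular := NegReg A ∧ PosReg C

/-- The confluent function `ℋ₄`. -/
noncomputable def ℋ4 {N : ℕ} (A B' C : Mat N) : Series N where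
  coeff m n := poch A (m - n) * poch B' n * (poch C m)⁻¹
  regular := NegReg A ∧ PosReg C

/-- The confluent function `ℋ₅`. -/
noncomputable def ℋ5 {N : ℕ} (A C : Mat N) : Series N where
  coeff m n := poch A (m - n) * (poch C m)⁻¹
  regular := NegReg A ∧ PosReg C

/-- The confluent function `ℋ₆`. -/
noncomputable def ℋ6 {N : ℕ} (A C : Mat N) : Series N where
  coeff m n := poch A (2 * m + n) * (poch C (m + n))⁻¹
  regular := PosReg C

/-- The confluent function `ℋ₇`. -/
noncomputable def ℋ7 {N : ℕ} (A C C' : Mat N) : Series N where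
  coeff m n := poch A (2 * m + n) * (poch C m)⁻¹ * (poch C' n)⁻¹
  regular := PosReg C ∧ PosReg C'

/-- The confluent function `ℋ₈`. -/
noncomputable def ℋ8 {N : ℕ} (A B : Mat N) : Series N where
  coeff m n := poch A (2 * m - n) * poch B (n - m)
  regular := NegReg A ∧ NegReg B

/-- The confluent function `ℋ₉`. -/
noncomputable def ℋ9 {N : ℕ} (A B C : Mat N) : Series N where
  coeff m n := poch A (2 * m - n) * poch B n * (poch C m)⁻¹
  regular := NegReg A ∧ PosReg C

/-- The confluent function `ℋ₁₀`. -/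
noncomputable def ℋ10 {N : ℕ} (A C : Mat N) : Series N where
  coeff m n := poch A (2 * m - n) * (poch C m)⁻¹
  regular := NegReg A ∧ PosReg C

/-- The confluent function `ℋ₁₁`. -/
noncomputable def ℋ11 {N : ℕ} (A B C C' : Mat N) : Series N where
  coeff m n := poch A (m - n) * poch B n * poch C n * (poch C' m)⁻¹
  regular := NegReg A ∧ PosReg C'

end HornMatrix

open HornMatrix

/-!
All the formulas are identities between coefficients, once the two kinds of operators are described
by their effect on a double series. On the one hand `∂_x^r` replaces the coefficients `c m n` by
`c (m + r) n`, and the law `(P)_{k+s} = (P)_s (P + s I)_k` pulls the constant factors out of each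
Pochhammer symbol. On the other hand, along a monomial curve `γ z = (x z^a, y z^b)` the term of
index `(m, n)` of `z^P F(γ z)` is a multiple of `z^(P + (a m + b n) I)`, on which `(z² d/dz)^r` acts
as `z^r` times the factor `(P + (a m + b n) I)_r`, and `(P + k I)_r (P)_k = (P)_r (P + r I)_k`. The
operator `d/dz` acts in the same way on `z^(C - I) F(γ z)`, with `(C - r I + k I)_r (C)_k⁻¹ =
(C - r I)_r (C - r I)_k⁻¹` for the coefficients. The commutation hypotheses move the constant
factors through the product of the Pochhammer symbols.
-/

namespace HornMatrix

variable {N : ℕ}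

attribute [local simp] Nat.cast_commute Nat.commute_cast Int.cast_commute Int.commute_cast

/-! ### Commutation -/

section Commute

@[simp]
theorem commute_two_left {R : Type*} [NonAssocSemiring R] (X : R) : Commute 2 X :=
  Commute.ofNat_left 2 X

@[simp]
theorem commute_two_right {R : Type*} [NonAssocSemiring R] (X : R) : Commute X 2 :=
  Commute.ofNat_right X 2

section Inverse

variable {ι R : Type*} [Fintype ι] [DecidableEq ι] [CommRing R] {X A : Matrix ι ι R}

@[simp]
theorem commute_inv_right (h : Commute X A) : Commute X A⁻¹ := by
  simpa using Matrix.Commute.zpow_right h (-1)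

@[simp]
theorem commute_inv_left (h : Commute A X) : Commute A⁻¹ X :=
  (commute_inv_right h.symm).symm

end Inverse

theorem commute_aeval_right {R E : Type*} [CommSemiring R] [Semiring E] [Algebra R E] {X A : E}
    (h : Commute X A) (p : Polynomial R) : Commute X (Polynomial.aeval A p) := by
  induction p using Polynomial.induction_on' with
  | add p q hp hq => simpa using hp.add_right hq
  | monomial n a =>
    rw [Polynomial.aeval_monomial]
    exact (Algebra.commute_algebraMap_right a X).mul_right (h.pow_right n)

variable {X A : Mat N}

@[simp]
theorem commute_poch_right (h : Commute X A) (k : ℤ) : Commute X (poch A k) := by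
  cases k with
  | ofNat n => exact commute_aeval_right h _
  | negSucc n =>
    exact ((Commute.one_right X).neg_right.pow_right _).mul_right
      (commute_inv_right (commute_aeval_right ((Commute.one_right X).sub_right h) _))

@[simp]
theorem commute_poch_left (h : Commute A X) (k : ℤ) : Commute (poch A k) X :=
  (commute_poch_right h.symm k).symm

theorem commute_mpow_right (h : Commute X A) (z : ℂ) : Commute X (mpow z A) :=
  (h.smul_right _).exp_right

end Commute

/-! ### Pochhammer symbols -/

section Pochhammer

variable {A C : Mat N} {k s : ℤ}

@[simp]
theorem poch_zero (A : Mat N) : poch A 0 = 1 := by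
  change Polynomial.aeval A (ascPochhammer ℂ 0) = 1
  simp

theorem poch_natCast_add_one (A : Mat N) (n : ℕ) :
    poch A ((n : ℤ) + 1) = poch A n * (A + (n : Mat N)) := by
  change Polynomial.aeval A (ascPochhammer ℂ (n + 1)) = Polynomial.aeval A (ascPochhammer ℂ n) * _
  simp [ascPochhammer_succ_right]

@[simp]
theorem poch_one (A : Mat N) : poch A 1 = A := by
  simpa using poch_natCast_add_one A 0

theorem poch_neg_natCast (A : Mat N) (n : ℕ) :
    poch A (-(n : ℤ)) = (-1) ^ n * (poch (1 - A) n)⁻¹ := by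
  cases n with
  | zero => simp
  | succ n => rfl

theorem PosReg.isUnit_poch (h : PosReg C) (n : ℕ) : IsUnit (poch C n) := by
  induction n with
  | zero => simp
  | succ n ih =>
    rw [Nat.cast_add_one, poch_natCast_add_one]
    exact ih.mul (by simpa using h n)

theorem NegReg.isUnit_sub (h : NegReg A) (n : ℕ) : IsUnit (A - ((n : Mat N) + 1)) := by
  simpa using h n

theorem NegReg.poch_neg_mul (h : NegReg A) (n : ℕ) :
    poch A (-(n + 1 : ℤ)) * (A - ((n : Mat N) + 1)) = poch A (-n) := by
  have hneg : A - ((n : Mat N) + 1) = -(1 - A + (n : Mat N)) := by abel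
  have hdet : IsUnit (1 - A + (n : Mat N)).det :=
    (Matrix.isUnit_iff_isUnit_det _).1 (IsUnit.neg_iff _ |>.1 (hneg ▸ h.isUnit_sub n))
  have hcomm : Commute (poch (1 - A) n)⁻¹ (1 - A + (n : Mat N)) := by simp (maxDischargeDepth := 9)
  rw [← Nat.cast_add_one, poch_neg_natCast, poch_neg_natCast, Nat.cast_add_one,
    poch_natCast_add_one, Matrix.mul_inv_rev, hneg, pow_succ, mul_neg_one, neg_mul, neg_mul,
    mul_neg, neg_neg, mul_assoc, mul_assoc, hcomm.eq, Matrix.nonsing_inv_mul_cancel_left _ _ hdet]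

theorem poch_add_one (h : 0 ≤ k ∨ NegReg A) : poch A (k + 1) = poch A k * (A + (k : Mat N)) := by
  obtain ⟨n, rfl | rfl⟩ := k.eq_nat_or_neg
  · simpa using poch_natCast_add_one A n
  cases n with
  | zero => simp
  | succ n =>
    have hA : NegReg A := h.resolve_left (by omega)
    simpa [sub_eq_add_neg, add_comm, add_assoc] using (hA.poch_neg_mul n).symm

/-- Both sides satisfy the recursion `u (k + 1) = u k * (A + s + k)`, which can be run backwards
where `A + s + k` is invertible. -/
theorem poch_add (hA : 0 ≤ s ∧ 0 ≤ k ∨ NegReg A) (hk : 0 ≤ k ∨ NegReg (A + (s : Mat N))) :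
    poch A (k + s) = poch A s * poch (A + (s : Mat N)) k := by
  induction k using Int.induction_on with
  | zero => simp
  | succ n ih =>
    have hn : (0 : ℤ) ≤ n := n.cast_nonneg
    rw [add_right_comm, poch_add_one (hA.imp_left fun h => add_nonneg hn h.1),
      ih (hA.imp_left fun h => ⟨h.1, hn⟩) (.inl hn), poch_natCast_add_one, mul_assoc]
    push_cast
    rw [add_assoc, add_comm (s : Mat N)]
  | pred n ih =>
    have hA : NegReg A := hA.resolve_left (by omega)
    have hAs : NegReg (A + (s : Mat N)) := hk.resolve_left (by omega)
    refine (hAs.isUnit_sub n).mul_right_cancel ?_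
    calc poch A (-n - 1 + s) * (A + (s : Mat N) - ((n : Mat N) + 1))
        = poch A (-n - 1 + s + 1) := by
          rw [poch_add_one (.inr hA)]
          push_cast
          congr 1
          abel
      _ = poch A (-n + s) := by congr 1; ring
      _ = poch A s * poch (A + (s : Mat N)) (-(n + 1)) * (A + (s : Mat N) - ((n : Mat N) + 1)) := by
          rw [mul_assoc, hAs.poch_neg_mul, ih (.inr hA) (.inr hAs)]
      _ = poch A s * poch (A + (s : Mat N)) (-n - 1) * (A + (s : Mat N) - ((n : Mat N) + 1)) := by
          rw [neg_add']

theorem poch_sub_self (A : Mat N) (r : ℕ) : poch (A - r • 1) r = (-1) ^ r * poch (1 - A) r := by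
  induction r with
  | zero => simp
  | succ r ih =>
    have hA : A - (r + 1) • (1 : Mat N) + ((1 : ℤ) : Mat N) = A - r • 1 := by
      rw [add_smul, Int.cast_one, one_smul]
      abel
    have hneg : A - (r + 1) • (1 : Mat N) = -(1 - A + (r : Mat N)) := by
      rw [nsmul_eq_mul, mul_one]
      push_cast
      abel
    have hcomm : Commute (1 - A + (r : Mat N)) ((-1) ^ r * poch (1 - A) r) := by
      simp (maxDischargeDepth := 9)
    have hr : (0 : ℤ) ≤ r := r.cast_nonneg
    rw [Nat.cast_add_one, poch_add (.inl ⟨zero_le_one, hr⟩) (.inl hr), hA, ih, poch_one, hneg,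
      neg_mul, hcomm.eq, poch_natCast_add_one, pow_succ, mul_neg_one, neg_mul, mul_assoc]

theorem poch_mul_poch (r : ℕ) (h : 0 ≤ k ∨ NegReg A ∧ NegReg (A + r • 1)) :
    poch (A + (k : Mat N)) r * poch A k = poch A r * poch (A + r • 1) k := by
  have hr : (0 : ℤ) ≤ r := r.cast_nonneg
  have hcomm : Commute (poch (A + (k : Mat N)) r) (poch A k) := by
    simp (maxDischargeDepth := 9)
  have hcast : A + ((r : ℤ) : Mat N) = A + r • 1 := by simp
  rw [hcomm.eq, ← poch_add (h.imp (fun hk => ⟨hk, hr⟩) And.left) (.inl hr), add_comm,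
    poch_add (h.imp (fun hk => ⟨hr, hk⟩) And.left) (hcast ▸ h.imp_right And.right), hcast]

theorem poch_inv_mul_poch (r : ℕ) (hk : 0 ≤ k) (h : PosReg C) (h' : PosReg (C - r • 1)) :
    (poch C k)⁻¹ * poch (C - r • 1 + (k : Mat N)) r
      = (poch (C - r • 1) k)⁻¹ * ((-1) ^ r * poch (1 - C) r) := by
  have key := poch_mul_poch (A := C - r • 1) r (.inl hk)
  rw [sub_add_cancel, poch_sub_self] at key
  lift k to ℕ using hk
  have hu := (Matrix.isUnit_iff_isUnit_det _).1 (h.isUnit_poch k)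
  have hu' := (Matrix.isUnit_iff_isUnit_det _).1 (h'.isUnit_poch k)
  have hcomm : Commute (poch (C - r • 1 + ((k : ℤ) : Mat N)) r) (poch C k)⁻¹ := by
    simp (maxDischargeDepth := 9)
  have hcomm' : Commute (poch (C - r • 1 + ((k : ℤ) : Mat N)) r) (poch (C - r • 1) k) := by
    simp (maxDischargeDepth := 9)
  calc (poch C k)⁻¹ * poch (C - r • 1 + ((k : ℤ) : Mat N)) r
      = (poch (C - r • 1) k)⁻¹ * (poch (C - r • 1) k * poch (C - r • 1 + ((k : ℤ) : Mat N)) r)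
        * (poch C k)⁻¹ := by
        rw [Matrix.nonsing_inv_mul_cancel_left _ _ hu', hcomm.eq]
    _ = (poch (C - r • 1) k)⁻¹ * ((-1) ^ r * poch (1 - C) r) := by
        rw [← hcomm'.eq, key, mul_assoc, Matrix.mul_nonsing_inv_cancel_right _ _ hu]

end Pochhammer

/-! ### Double series and their region of convergence -/

section Series

variable {S T : Series N} {p q : ℂ × ℂ}

/-- The region of absolute convergence of a double series, regardless of whether its coefficients
are defined. -/
def Series.region (S : Series N) : Set (ℂ × ℂ) :=
  interior {q : ℂ × ℂ | Summable fun k => ‖S.term q k‖}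

theorem Series.isOpen_region (S : Series N) : IsOpen S.region := isOpen_interior

theorem Series.summable_term (h : p ∈ S.region) : Summable (S.term p) :=
  Summable.of_norm (interior_subset (s := {q | Summable fun k => ‖S.term q k‖}) h)

theorem Series.region_subset_region (h : ∀ p ∈ S.region, Summable (T.term p)) :
    S.region ⊆ T.region :=
  interior_maximal (fun p hp => (h p hp).norm) S.isOpen_region

theorem Series.eval_eq_mul {L R : Mat N} (h : p ∈ T.region)
    (hc : ∀ m n, S.coeff m n = L * T.coeff m n * R) : S p = L * T p * R := by
  have hterm : S.term p = fun k => L * T.term p k * R := by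
    funext k
    simp only [Series.term, hc, mul_smul_comm, smul_mul_assoc]
  rw [Series.eval, hterm, Summable.tsum_mul_right _ ((T.summable_term h).mul_left L),
    Summable.tsum_mul_left _ (T.summable_term h), Series.eval]

theorem Series.norm_term_le (S : Series N) (h₁ : ‖p.1‖ ≤ ‖q.1‖) (h₂ : ‖p.2‖ ≤ ‖q.2‖)
    (k : ℕ × ℕ) : ‖S.term p k‖ ≤ ‖S.term q k‖ := by
  simp only [Series.term, norm_smul, norm_div, norm_mul, norm_pow]
  gcongr

theorem exists_norm_gt_of_mem_nhds {E : Type*} [NormedAddCommGroup E] [NormedSpace ℝ E]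
    [Nontrivial E] {U : Set E} {x : E} (hU : U ∈ nhds x) : ∃ x' ∈ U, ‖x‖ < ‖x'‖ := by
  by_contra! hle
  have hx : x ∈ interior (Metric.closedBall 0 ‖x‖) :=
    mem_interior_iff_mem_nhds.2 (Filter.mem_of_superset hU fun x' hx' => by simpa using hle x' hx')
  simp [interior_closedBall'] at hx

theorem Series.exists_bound (hp : p ∈ S.region) :
    ∃ V : Set (ℂ × ℂ), IsOpen V ∧ p ∈ V ∧ ∃ u : ℕ × ℕ → ℝ, Summable u ∧
      ∀ k, ∀ q ∈ V, ‖S.term q k‖ ≤ u k := by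
  obtain ⟨U₁, hU₁, U₂, hU₂, hU⟩ := mem_nhds_prod_iff.1 (mem_interior_iff_mem_nhds.1 hp)
  obtain ⟨x', hx', hx⟩ := exists_norm_gt_of_mem_nhds hU₁
  obtain ⟨y', hy', hy⟩ := exists_norm_gt_of_mem_nhds hU₂
  refine ⟨{q | ‖q.1‖ < ‖x'‖ ∧ ‖q.2‖ < ‖y'‖}, ?_, ⟨hx, hy⟩, fun k => ‖S.term (x', y') k‖,
    hU (Set.mk_mem_prod hx' hy'), fun k q hq => S.norm_term_le hq.1.le hq.2.le k⟩
  exact (isOpen_lt continuous_fst.norm continuous_const).inter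
    (isOpen_lt continuous_snd.norm continuous_const)

end Series

section Curve

variable {S : Series N} {γ : ℂ → ℂ × ℂ} {z : ℂ}

theorem Series.exists_nhds (hγ : ∀ᶠ w in nhds z, DifferentiableAt ℂ γ w) (hz : γ z ∈ S.region) :
    ∃ U : Set ℂ, IsOpen U ∧ z ∈ U ∧ (∀ k, DifferentiableOn ℂ (fun w => S.term (γ w) k) U) ∧
      ∃ u : ℕ × ℕ → ℝ, Summable u ∧ ∀ k, ∀ w ∈ U, ‖S.term (γ w) k‖ ≤ u k := by
  obtain ⟨V, hV, hzV, u, hu, hle⟩ := S.exists_bound hz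
  have hVz : ∀ᶠ w in nhds z, γ w ∈ V :=
    hγ.self_of_nhds.continuousAt.eventually_mem (hV.mem_nhds hzV)
  obtain ⟨U, hU, hUo, hzU⟩ := eventually_nhds_iff.1 (hγ.and hVz)
  refine ⟨U, hUo, hzU, fun k w hw => ?_, u, hu, fun k w hw => hle k _ (hU w hw).2⟩
  have := (hU w hw).1
  unfold Series.term
  exact DifferentiableAt.differentiableWithinAt (by fun_prop)

theorem Series.analyticAt_comp (hγ : ∀ᶠ w in nhds z, DifferentiableAt ℂ γ w)
    (hz : γ z ∈ S.region) : AnalyticAt ℂ (fun w => S (γ w)) z := by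
  obtain ⟨U, hU, hzU, hd, u, hu, hle⟩ := S.exists_nhds hγ hz
  exact (Complex.differentiableOn_tsum_of_summable_norm hu hd hU hle).analyticAt (hU.mem_nhds hzU)

theorem Series.hasSum_deriv_comp (hγ : ∀ᶠ w in nhds z, DifferentiableAt ℂ γ w)
    (hz : γ z ∈ S.region) :
    HasSum (fun k => deriv (fun w => S.term (γ w) k) z) (deriv (fun w => S (γ w)) z) := by
  obtain ⟨U, hU, hzU, hd, u, hu, hle⟩ := S.exists_nhds hγ hz
  exact Complex.hasSum_deriv_of_summable_norm hu hd hU hle hzU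

end Curve

/-! ### Derivatives in one of the variables -/

section PartialDerivatives

variable {S T : Series N} {r : ℕ} {x y : ℂ} {L R : Mat N}

/-- The series whose sum is the `r`-th derivative of that of `S` in the first variable. -/
def Series.shiftX (S : Series N) (r : ℕ) : Series N := ⟨fun m n => S.coeff (m + r) n, S.regular⟩

theorem Series.shiftX_shiftX_one (S : Series N) (r : ℕ) :
    (S.shiftX r).shiftX 1 = S.shiftX (r + 1) := by
  simp only [Series.shiftX, add_assoc, add_comm 1 r]

theorem Series.deriv_term_succ (S : Series N) (x y : ℂ) (k : ℕ × ℕ) :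
    deriv (fun z => S.term (z, y) (k.1 + 1, k.2)) x = (S.shiftX 1).term (x, y) k := by
  have hx : HasDerivAt (fun z => S.term (z, y) (k.1 + 1, k.2)) _ x :=
    (((hasDerivAt_pow (k.1 + 1) x).mul_const (y ^ k.2)).div_const _).smul_const _
  have : ((k.1 : ℂ) + 1) ≠ 0 := by exact_mod_cast k.1.succ_ne_zero
  have : (k.1.factorial : ℂ) ≠ 0 := by exact_mod_cast k.1.factorial_ne_zero
  have : (k.2.factorial : ℂ) ≠ 0 := by exact_mod_cast k.2.factorial_ne_zero
  rw [hx.deriv, Series.term, Series.shiftX, Nat.add_sub_cancel, Nat.factorial_succ]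
  congr 1
  push_cast
  field_simp

theorem Series.hasSum_shiftX_one (h : (x, y) ∈ S.region) :
    HasSum ((S.shiftX 1).term (x, y)) (deriv (fun z => S (z, y)) x) := by
  have hs := S.hasSum_deriv_comp (γ := fun z => (z, y)) (.of_forall fun w => by fun_prop) h
  have hinj : Function.Injective (Prod.map (· + 1) id : ℕ × ℕ → ℕ × ℕ) :=
    (add_left_injective 1).prodMap Function.injective_id
  rw [← hinj.hasSum_iff] at hs
  · exact hs.congr_fun fun k => (S.deriv_term_succ x y k).symm
  · rintro ⟨m, n⟩ hk
    cases m with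
    | zero => simp [Series.term]
    | succ m => exact absurd ⟨(m, n), rfl⟩ hk

theorem Series.region_subset_shiftX (S : Series N) (r : ℕ) : S.region ⊆ (S.shiftX r).region := by
  induction r with
  | zero => exact subset_rfl
  | succ r ih =>
    rw [← S.shiftX_shiftX_one]
    exact ih.trans (Series.region_subset_region fun p hp => (Series.hasSum_shiftX_one hp).summable)

theorem Series.iterate_deriv (h : (x, y) ∈ S.region) :
    deriv^[r] (fun z => S (z, y)) x = S.shiftX r (x, y) := by
  induction r generalizing x with
  | zero => rfl
  | succ r ih =>
    have hcont : ContinuousAt (fun z : ℂ => (z, y)) x := by fun_prop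
    have hev : deriv^[r] (fun z => S (z, y)) =ᶠ[nhds x] fun z => S.shiftX r (z, y) := by
      filter_upwards [hcont.eventually_mem (S.isOpen_region.mem_nhds h)] with z hz using ih hz
    rw [Function.iterate_succ_apply', hev.deriv_eq, ← S.shiftX_shiftX_one]
    exact (Series.hasSum_shiftX_one (S.region_subset_shiftX r h)).tsum_eq.symm

theorem DiffX.of_coeff
    (h : S.regular → T.regular → ∀ m n, S.coeff (m + r) n = L * T.coeff m n * R) :
    DiffX r S L T R := fun x y ⟨hS, hT⟩ =>
  ⟨S.analyticAt_comp (γ := fun z => (z, y)) (.of_forall fun w => by fun_prop) hS.2,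
    (S.iterate_deriv hS.2).trans (Series.eval_eq_mul hT.2 (h hS.1 hT.1))⟩

/-- The series with the roles of the two variables exchanged. -/
def Series.swap (S : Series N) : Series N := ⟨fun m n => S.coeff n m, S.regular⟩

theorem Series.term_swap (S : Series N) (p : ℂ × ℂ) :
    S.swap.term p.swap = S.term p ∘ Prod.swap := by
  funext k
  simp only [Series.term, Series.swap, Function.comp_apply, Prod.fst_swap, Prod.snd_swap]
  rw [mul_comm (p.2 ^ k.1), mul_comm (k.1.factorial : ℂ)]

theorem Series.eval_swap (S : Series N) (p : ℂ × ℂ) : S.swap p.swap = S p := by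
  rw [Series.eval, S.term_swap p]
  exact (Equiv.prodComm ℕ ℕ).tsum_eq (S.term p)

theorem Series.swap_mem_region_swap (S : Series N) (p : ℂ × ℂ) :
    p.swap ∈ S.swap.region ↔ p ∈ S.region := by
  have hsummable (p : ℂ × ℂ) :
      (Summable fun k => ‖S.swap.term p.swap k‖) ↔ Summable fun k => ‖S.term p k‖ := by
    rw [S.term_swap p]
    exact (Equiv.prodComm ℕ ℕ).summable_iff (f := fun k => ‖S.term p k‖)
  have hpreimage : Homeomorph.prodComm ℂ ℂ ⁻¹' S.swap.region = S.region :=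
    ((Homeomorph.prodComm ℂ ℂ).preimage_interior _).trans
      (congrArg interior (Set.ext hsummable))
  exact Set.ext_iff.1 hpreimage p

theorem DiffX.swap (h : DiffX r S.swap L T.swap R) : DiffY r S L T R := fun x y ⟨hS, hT⟩ => by
  have hX := h y x
    ⟨⟨hS.1, (S.swap_mem_region_swap (x, y)).2 hS.2⟩, hT.1, (T.swap_mem_region_swap (x, y)).2 hT.2⟩
  have hS' (z : ℂ) : S.swap (z, x) = S (x, z) := S.eval_swap (x, z)
  have hT' : T.swap (y, x) = T (x, y) := T.eval_swap (x, y)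
  simpa only [hS', hT'] using hX

theorem DiffY.of_coeff
    (h : S.regular → T.regular → ∀ m n, S.coeff m (n + r) = L * T.coeff m n * R) :
    DiffY r S L T R :=
  DiffX.swap (DiffX.of_coeff fun hS hT m n => h hS hT n m)

end PartialDerivatives

/-! ### Derivatives along monomial curves, with matrix powers as factors -/

section MatrixPower

variable {z : ℂ} (P Q : Mat N)

@[simp]
theorem mpow_zero (z : ℂ) : mpow z (0 : Mat N) = 1 := by
  simp [mpow]

theorem hasDerivAt_mpow (hz : z ∈ Complex.slitPlane) :
    HasDerivAt (fun w => mpow w P) (z⁻¹ • (P * mpow z P)) z :=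
  (hasDerivAt_exp_smul_const' (𝕂 := ℂ) P (Complex.log z)).scomp z (Complex.hasDerivAt_log hz)

theorem mpow_add_intCast (hz : z ≠ 0) (k : ℤ) : mpow z (P + (k : Mat N)) = z ^ k • mpow z P := by
  have hcomm : Commute (Complex.log z • P) (Complex.log z • (k : Mat N)) :=
    ((Int.commute_cast P k).smul_right _).smul_left _
  have hcast : Complex.log z • (k : Mat N) = algebraMap ℂ (Mat N) (k * Complex.log z) := by
    rw [Algebra.algebraMap_eq_smul_one, mul_comm, mul_smul, Int.cast_smul_eq_zsmul, zsmul_one]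
  rw [mpow, smul_add, Matrix.exp_add_of_commute _ _ hcomm, hcast, ← NormedSpace.algebraMap_exp_comm,
    ← Complex.exp_eq_exp_ℂ, Complex.exp_int_mul, Complex.exp_log hz,
    Algebra.algebraMap_eq_smul_one, mul_smul_comm, mul_one, mpow]

end MatrixPower

section MonomialCurve

variable {S : Series N} {x y z : ℂ} {a b : ℤ}

/-- The curve `z ↦ (x z ^ a, y z ^ b)`, along which the term of index `(m, n)` of a double series is
proportional to `z ^ (a m + b n)`. -/
noncomputable def monomialCurve (x y : ℂ) (a b : ℤ) (z : ℂ) : ℂ × ℂ := (x * z ^ a, y * z ^ b)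

theorem eventually_differentiableAt_monomialCurve (x y : ℂ) (a b : ℤ) (hz : z ≠ 0) :
    ∀ᶠ w in nhds z, DifferentiableAt ℂ (monomialCurve x y a b) w := by
  filter_upwards [isOpen_ne.mem_nhds hz] with w hw
  exact ((differentiableAt_zpow.2 (.inl hw)).const_mul x).prodMk
    ((differentiableAt_zpow.2 (.inl hw)).const_mul y)

theorem Series.eventually_mem_region (hz : z ≠ 0) (h : monomialCurve x y a b z ∈ S.region) :
    ∀ᶠ w in nhds z, monomialCurve x y a b w ∈ S.region :=
  (eventually_differentiableAt_monomialCurve x y a b hz).self_of_nhds.continuousAt.eventually_mem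
    (S.isOpen_region.mem_nhds h)

theorem Series.term_monomialCurve (S : Series N) (x y : ℂ) (a b : ℤ) (hz : z ≠ 0) (k : ℕ × ℕ) :
    S.term (monomialCurve x y a b z) k = z ^ (a * k.1 + b * k.2) • S.term (x, y) k := by
  simp only [Series.term, monomialCurve, mul_pow, zpow_add₀ hz, zpow_mul, zpow_natCast, smul_smul]
  congr 1
  ring

/-- The series whose sum is obtained from that of `S` by the operator `a x ∂/∂x + b y ∂/∂y`. -/
def Series.theta (S : Series N) (a b : ℤ) : Series N :=
  ⟨fun m n => (a * m + b * n : ℤ) • S.coeff m n, S.regular⟩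

theorem Series.hasSum_theta (hz : z ≠ 0) (h : monomialCurve x y a b z ∈ S.region) :
    HasSum ((S.theta a b).term (monomialCurve x y a b z))
      (z • deriv (fun w => S (monomialCurve x y a b w)) z) := by
  refine ((S.hasSum_deriv_comp (eventually_differentiableAt_monomialCurve x y a b hz)
    h).const_smul z).congr_fun fun k => ?_
  have hev : (fun w => S.term (monomialCurve x y a b w) k) =ᶠ[nhds z]
      fun w => w ^ (a * k.1 + b * k.2) • S.term (x, y) k := by
    filter_upwards [isOpen_ne.mem_nhds hz] with w hw using S.term_monomialCurve x y a b hw k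
  rw [hev.deriv_eq, ((hasDerivAt_zpow _ z (.inl hz)).smul_const _).deriv,
    Series.term_monomialCurve _ _ _ _ _ hz, zpow_sub_one₀ hz]
  simp only [Series.term, Series.theta, ← Int.cast_smul_eq_zsmul ℂ, smul_smul]
  congr 1
  field_simp

theorem Series.region_subset_theta (S : Series N) (a b : ℤ) : S.region ⊆ (S.theta a b).region :=
  Series.region_subset_region fun p hp => by
    have hone : monomialCurve p.1 p.2 a b 1 = p := by simp [monomialCurve]
    rw [← hone] at hp ⊢
    exact (Series.hasSum_theta one_ne_zero hp).summable

/-- The series whose sum is obtained from that of `S` by the operator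
`F ↦ P F + a x ∂F/∂x + b y ∂F/∂y + F Q`. -/
def Series.euler (S : Series N) (a b : ℤ) (P Q : Mat N) : Series N :=
  ⟨fun m n => P * S.coeff m n + (S.theta a b).coeff m n + S.coeff m n * Q, S.regular⟩

theorem Series.coeff_euler (S : Series N) (a b : ℤ) (P Q : Mat N) (m n : ℕ) :
    (S.euler a b P Q).coeff m n
      = P * S.coeff m n + ((a * m + b * n : ℤ) : Mat N) * S.coeff m n + S.coeff m n * Q := by
  rw [← zsmul_eq_mul, euler, theta]

theorem Series.term_euler (S : Series N) (a b : ℤ) (P Q : Mat N) (p : ℂ × ℂ) (k : ℕ × ℕ) :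
    (S.euler a b P Q).term p k = P * S.term p k + (S.theta a b).term p k + S.term p k * Q := by
  simp only [Series.term, Series.euler, smul_add, mul_smul_comm, smul_mul_assoc]

theorem Series.region_subset_euler (S : Series N) (a b : ℤ) (P Q : Mat N) :
    S.region ⊆ (S.euler a b P Q).region :=
  Series.region_subset_region fun p hp => by
    have h := S.summable_term hp
    have hθ := (S.theta a b).summable_term (S.region_subset_theta a b hp)
    exact (((h.mul_left P).add hθ).add (h.mul_right Q)).congr fun k =>
      (S.term_euler a b P Q p k).symm

theorem Series.eval_euler (P Q : Mat N) (hz : z ≠ 0) (h : monomialCurve x y a b z ∈ S.region) :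
    (S.euler a b P Q) (monomialCurve x y a b z) = P * S (monomialCurve x y a b z)
      + z • deriv (fun w => S (monomialCurve x y a b w)) z + S (monomialCurve x y a b z) * Q :=
  have hs := (S.summable_term h).hasSum
  (((hs.mul_left P).add (Series.hasSum_theta hz h)).add (hs.mul_right Q)).congr_fun
    (S.term_euler a b P Q _) |>.tsum_eq

theorem Series.hasDerivAt_mpow_mul (P Q : Mat N) (hz : z ∈ Complex.slitPlane)
    (h : monomialCurve x y a b z ∈ S.region) :
    HasDerivAt (fun w => mpow w P * S (monomialCurve x y a b w) * mpow w Q)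
      (z⁻¹ • (mpow z P * (S.euler a b P Q) (monomialCurve x y a b z) * mpow z Q)) z := by
  have hz0 := Complex.slitPlane_ne_zero hz
  have hS := (S.analyticAt_comp (eventually_differentiableAt_monomialCurve x y a b hz0)
    h).differentiableAt.hasDerivAt
  refine (((hasDerivAt_mpow P hz).mul hS).mul (hasDerivAt_mpow Q hz)).congr_deriv ?_
  rw [Series.eval_euler P Q hz0 h, Pi.mul_apply, (commute_mpow_right (Commute.refl P) z).eq]
  simp only [mul_add, add_mul, smul_add, smul_mul_assoc, mul_smul_comm, smul_smul,
    inv_mul_cancel₀ hz0, one_smul, mul_assoc]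

theorem Series.analyticAt_mpow_mul (P Q : Mat N) (hz : z ∈ Complex.slitPlane)
    (h : monomialCurve x y a b z ∈ S.region) :
    AnalyticAt ℂ (fun w => mpow w P * S (monomialCurve x y a b w) * mpow w Q) z :=
  DifferentiableOn.analyticAt (s := Complex.slitPlane ∩ {w | monomialCurve x y a b w ∈ S.region})
    (fun _ hw => (S.hasDerivAt_mpow_mul P Q hw.1 hw.2).differentiableAt.differentiableWithinAt)
    (Filter.inter_mem (Complex.isOpen_slitPlane.mem_nhds hz)
      (Series.eventually_mem_region (Complex.slitPlane_ne_zero hz) h))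

end MonomialCurve

section Iteration

variable {S : Series N} {x y z : ℂ} {ε a b : ℤ} {P Q : Mat N} {r : ℕ}

/-- The operator `z ^ (1 + ε) d/dz`, a common form of `sqDeriv` (`ε = 1`) and `deriv` (`ε = -1`). -/
noncomputable def eulerOp (ε : ℤ) (f : ℂ → Mat N) : ℂ → Mat N := fun z => z ^ (1 + ε) • deriv f z

theorem eulerOp_one : eulerOp (N := N) 1 = sqDeriv := rfl

theorem eulerOp_neg_one : eulerOp (N := N) (-1) = deriv := by
  funext f z
  simp [eulerOp]

/-- The series `T` for which `r` applications of `z ^ (1 + ε) d/dz` turn `z ^ P * S * z ^ Q` into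
`z ^ (P + ε r) * T * z ^ Q` along the curves `z ↦ (x z ^ a, y z ^ b)`. -/
def Series.eulerIter (S : Series N) (ε a b : ℤ) (P Q : Mat N) : ℕ → Series N
  | 0 => S
  | r + 1 => (S.eulerIter ε a b P Q r).euler a b (P + ((ε * r : ℤ) : Mat N)) Q

theorem Series.region_subset_eulerIter (S : Series N) (ε a b : ℤ) (P Q : Mat N) (r : ℕ) :
    S.region ⊆ (S.eulerIter ε a b P Q r).region := by
  induction r with
  | zero => exact subset_rfl
  | succ r ih => exact ih.trans (Series.region_subset_euler _ a b _ _)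

theorem Series.iterate_eulerOp (hz : z ∈ Complex.slitPlane)
    (h : monomialCurve x y a b z ∈ S.region) :
    (eulerOp ε)^[r] (fun w => mpow w P * S (monomialCurve x y a b w) * mpow w Q) z
      = mpow z (P + ((ε * r : ℤ) : Mat N))
        * (S.eulerIter ε a b P Q r) (monomialCurve x y a b z) * mpow z Q := by
  induction r generalizing z with
  | zero => simp [Series.eulerIter]
  | succ r ih =>
    have hz0 := Complex.slitPlane_ne_zero hz
    have hev : (eulerOp ε)^[r] (fun w => mpow w P * S (monomialCurve x y a b w) * mpow w Q)
        =ᶠ[nhds z] fun w => mpow w (P + ((ε * r : ℤ) : Mat N))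
          * (S.eulerIter ε a b P Q r) (monomialCurve x y a b w) * mpow w Q := by
      filter_upwards [Complex.isOpen_slitPlane.mem_nhds hz, Series.eventually_mem_region hz0 h]
        with w hw hw' using ih hw hw'
    have hpow : mpow z (P + ((ε * (r + 1 : ℕ) : ℤ) : Mat N))
        = (z ^ (1 + ε) * z⁻¹) • mpow z (P + ((ε * r : ℤ) : Mat N)) := by
      rw [← zpow_sub_one₀ hz0, add_sub_cancel_left, ← mpow_add_intCast _ hz0, add_assoc]
      push_cast
      rw [mul_add, mul_one]
    rw [Function.iterate_succ_apply', eulerOp, hev.deriv_eq,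
      (Series.hasDerivAt_mpow_mul _ Q hz (S.region_subset_eulerIter ε a b P Q r h)).deriv, hpow,
      smul_smul, smul_mul_assoc, smul_mul_assoc, Series.eulerIter]

theorem Series.coeff_eulerIter_left (m n : ℕ) :
    (S.eulerIter 1 a b P 0 r).coeff m n
      = poch (P + ((a * m + b * n : ℤ) : Mat N)) r * S.coeff m n := by
  induction r with
  | zero => simp [Series.eulerIter]
  | succ r ih =>
    have hcomm : Commute (P + ((a * m + b * n : ℤ) : Mat N) + r)
        (poch (P + ((a * m + b * n : ℤ) : Mat N)) r) := by simp
    rw [Nat.cast_add_one, poch_natCast_add_one, ← hcomm.eq, mul_assoc, ← ih, Series.eulerIter,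
      Series.coeff_euler, mul_zero, add_zero, ← add_mul, add_right_comm,
      one_mul, Int.cast_natCast]

theorem Series.coeff_eulerIter_right (m n : ℕ) :
    (S.eulerIter 1 a b 0 Q r).coeff m n
      = S.coeff m n * poch (Q + ((a * m + b * n : ℤ) : Mat N)) r := by
  induction r with
  | zero => simp [Series.eulerIter]
  | succ r ih =>
    rw [Nat.cast_add_one, poch_natCast_add_one, ← mul_assoc, ← ih, Series.eulerIter,
      Series.coeff_euler, zero_add, (Int.cast_commute _ _).eq, (Int.cast_commute _ _).eq,
      ← mul_add, ← mul_add, one_mul, Int.cast_natCast]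
    congr 1
    abel

theorem Series.coeff_eulerIter_lower (C : Mat N) (m n : ℕ) :
    (S.eulerIter (-1) a b 0 (C - 1) r).coeff m n
      = S.coeff m n * poch (C - r • 1 + ((a * m + b * n : ℤ) : Mat N)) r := by
  induction r with
  | zero => simp [Series.eulerIter]
  | succ r ih =>
    set D : Mat N := C - (r + 1) • 1 + ((a * m + b * n : ℤ) : Mat N) with hD
    have hD' : C - r • 1 + ((a * m + b * n : ℤ) : Mat N) = D + ((1 : ℤ) : Mat N) := by
      rw [hD, add_smul, Int.cast_one, one_smul]
      abel
    have hr : (0 : ℤ) ≤ r := r.cast_nonneg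
    have hcomm : Commute D (poch (D + ((1 : ℤ) : Mat N)) r) := by simp
    rw [Nat.cast_add_one, poch_add (.inl ⟨zero_le_one, hr⟩) (.inl hr), poch_one, hcomm.eq,
      ← mul_assoc, ← hD', ← ih, Series.eulerIter, Series.coeff_euler,
      zero_add, (Int.cast_commute _ _).eq, (Int.cast_commute _ _).eq, ← mul_add, ← mul_add, hD,
      add_smul, nsmul_one, one_smul]
    congr 1
    push_cast
    rw [neg_one_mul]
    abel

end Iteration

/-! ### Coefficients after a shift of one parameter -/

section Shift

variable {r : ℕ} {P C U X Y Z : Mat N} {j k : ℤ}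

/-- Multiplying the coefficient `X` on the left by `(P + k)_r` has the same effect as replacing it
by `(P)_r Y`: the condition on the coefficients in rules of the form `PowLeft`. -/
def ShiftsLeft (r : ℕ) (P : Mat N) (k : ℤ) (X Y : Mat N) : Prop :=
  poch (P + (k : Mat N)) r * X = poch P r * Y

/-- The mirror image of `ShiftsLeft`: the condition on the coefficients in rules of the forms
`PowRight` and, with `P = C - r I`, `PowLower`. -/
def ShiftsRight (r : ℕ) (P : Mat N) (k : ℤ) (X Y : Mat N) : Prop :=
  X * poch (P + (k : Mat N)) r = Y * poch P r

theorem ShiftsLeft.poch_self (h : 0 ≤ j ∨ NegReg P ∧ NegReg (P + r • 1) := by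
      first | exact .inl (by omega) | exact .inr ⟨‹_›, ‹_›⟩)
    (hjk : j = k := by omega) :
    ShiftsLeft r P k (poch P j) (poch (P + r • 1) j) :=
  hjk ▸ poch_mul_poch r h

theorem ShiftsLeft.mul_const (h : ShiftsLeft r P k X Y) : ShiftsLeft r P k (X * Z) (Y * Z) := by
  rw [ShiftsLeft, ← mul_assoc, h, mul_assoc]

theorem ShiftsLeft.const_mul (h : ShiftsLeft r P k X Y)
    (hcomm : Commute U P := by simp (maxDischargeDepth := 9) [*]) :
    ShiftsLeft r P k (U * X) (U * Y) := by
  have hU : Commute U (poch (P + (k : Mat N)) r) := by simp [hcomm]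
  rw [ShiftsLeft, ← mul_assoc, ← hU.eq, mul_assoc, h, ← mul_assoc,
    (commute_poch_right hcomm r).eq, mul_assoc]

theorem ShiftsRight.poch_self (h : 0 ≤ j ∨ NegReg P ∧ NegReg (P + r • 1) := by
      first | exact .inl (by omega) | exact .inr ⟨‹_›, ‹_›⟩)
    (hjk : j = k := by omega) :
    ShiftsRight r P k (poch P j) (poch (P + r • 1) j) := by
  have hcomm : Commute (poch P j) (poch (P + (k : Mat N)) r) := by
    simp (maxDischargeDepth := 9)
  have hcomm' : Commute (poch P r) (poch (P + r • 1) j) := by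
    simp (maxDischargeDepth := 9)
  rw [ShiftsRight, hcomm.eq, ← hcomm'.eq]
  exact ShiftsLeft.poch_self h hjk

theorem ShiftsRight.poch_inv_self (h : PosReg C := by assumption)
    (h' : PosReg (C - r • 1) := by assumption) (hj : 0 ≤ j := by omega)
    (hjk : j = k := by omega) :
    ShiftsRight r (C - r • 1) k (poch C j)⁻¹ (poch (C - r • 1) j)⁻¹ := by
  rw [ShiftsRight, ← hjk, poch_inv_mul_poch r hj h h', poch_sub_self]

theorem ShiftsRight.const_mul (h : ShiftsRight r P k X Y) : ShiftsRight r P k (U * X) (U * Y) := by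
  rw [ShiftsRight, mul_assoc, h, mul_assoc]

theorem ShiftsRight.mul_const (h : ShiftsRight r P k X Y)
    (hcomm : Commute P Z := by simp (maxDischargeDepth := 9) [*]) :
    ShiftsRight r P k (X * Z) (Y * Z) := by
  have hZ : Commute (poch (P + (k : Mat N)) r) Z := by simp [hcomm]
  rw [ShiftsRight, mul_assoc, ← hZ.eq, ← mul_assoc, h, mul_assoc,
    (commute_poch_left hcomm r).eq, mul_assoc]

end Shift

section PowerRules

variable {r : ℕ} {S T : Series N} {γ : ℂ → ℂ × ℂ} {x y z : ℂ} {ε a b : ℤ} {P Q C K : Mat N}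

theorem Series.iteratesTo_mpow_mul (hz : z ∈ Complex.slitPlane)
    (hS : monomialCurve x y a b z ∈ S.region) (hT : monomialCurve x y a b z ∈ T.region)
    (hcoeff : ∀ m n, (S.eulerIter ε a b P 0 r).coeff m n = K * T.coeff m n) :
    IteratesTo (eulerOp ε) r (fun w => mpow w P * S (monomialCurve x y a b w)) z
      (mpow z (P + ((ε * r : ℤ) : Mat N)) * K * T (monomialCurve x y a b z)) := by
  have han := Series.analyticAt_mpow_mul P 0 hz hS
  have hiter := Series.iterate_eulerOp (ε := ε) (P := P) (Q := 0) (r := r) hz hS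
  rw [Series.eval_eq_mul hT fun m n => (hcoeff m n).trans (mul_one _).symm, mul_one] at hiter
  simp only [mpow_zero, mul_one] at han hiter
  exact ⟨han, hiter.trans (mul_assoc _ _ _).symm⟩

theorem Series.iteratesTo_mul_mpow (hz : z ∈ Complex.slitPlane)
    (hS : monomialCurve x y a b z ∈ S.region) (hT : monomialCurve x y a b z ∈ T.region)
    (hcoeff : ∀ m n, (S.eulerIter ε a b 0 Q r).coeff m n = T.coeff m n * K) (hcomm : Commute K Q) :
    IteratesTo (eulerOp ε) r (fun w => S (monomialCurve x y a b w) * mpow w Q) z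
      (T (monomialCurve x y a b z) * mpow z (Q + ((ε * r : ℤ) : Mat N)) * K) := by
  have hz0 := Complex.slitPlane_ne_zero hz
  have han := Series.analyticAt_mpow_mul 0 Q hz hS
  have hiter := Series.iterate_eulerOp (ε := ε) (P := 0) (Q := Q) (r := r) hz hS
  rw [Series.eval_eq_mul hT fun m n => (hcoeff m n).trans (congrArg (· * K) (one_mul _).symm),
    mpow_add_intCast _ hz0, smul_mul_assoc, smul_mul_assoc] at hiter
  simp only [mpow_zero, one_mul] at han hiter
  refine ⟨han, hiter.trans ?_⟩
  rw [mpow_add_intCast _ hz0, mul_smul_comm, smul_mul_assoc, mul_assoc, mul_assoc,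
    (commute_mpow_right hcomm z).eq]

theorem PowLeft.of_coeff (x y : ℂ) (a b : ℤ)
    (h : S.regular → T.regular → ∀ m n : ℕ,
      ShiftsLeft r P (a * m + b * n) (S.coeff m n) (T.coeff m n))
    (hγ : γ = monomialCurve x y a b := by
      funext; simp [monomialCurve, div_eq_mul_inv, zpow_ofNat, mul_comm]) :
    PowLeft r P S T γ := fun z hz hγz => by
  subst hγ
  have hcoeff (m n : ℕ) := (Series.coeff_eulerIter_left m n).trans (h hγz.1.1 hγz.2.1 m n)
  simpa [eulerOp_one] using Series.iteratesTo_mpow_mul hz hγz.1.2 hγz.2.2 hcoeff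

theorem PowRight.of_coeff (x y : ℂ) (a b : ℤ)
    (h : S.regular → T.regular → ∀ m n : ℕ,
      ShiftsRight r P (a * m + b * n) (S.coeff m n) (T.coeff m n))
    (hγ : γ = monomialCurve x y a b := by
      funext; simp [monomialCurve, div_eq_mul_inv, zpow_ofNat, mul_comm]) :
    PowRight r P S T γ := fun z hz hγz => by
  subst hγ
  have hcoeff (m n : ℕ) := (Series.coeff_eulerIter_right m n).trans (h hγz.1.1 hγz.2.1 m n)
  simpa [eulerOp_one] using Series.iteratesTo_mul_mpow hz hγz.1.2 hγz.2.2 hcoeff (by simp)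

theorem PowLower.of_coeff (x y : ℂ) (a b : ℤ)
    (h : S.regular → T.regular → ∀ m n : ℕ,
      ShiftsRight r (C - r • 1) (a * m + b * n) (S.coeff m n) (T.coeff m n))
    (hγ : γ = monomialCurve x y a b := by
      funext; simp [monomialCurve, div_eq_mul_inv, zpow_ofNat, mul_comm]) :
    PowLower r C S T γ := fun z hz hγz => by
  subst hγ
  have hcoeff (m n : ℕ) := (Series.coeff_eulerIter_lower C m n).trans (h hγz.1.1 hγz.2.1 m n)
  have hcomm : Commute (poch (C - r • 1) r) (C - 1) := by simp (maxDischargeDepth := 9)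
  have key := Series.iteratesTo_mul_mpow hz hγz.1.2 hγz.2.2 hcoeff hcomm
  have hexp : C - 1 + ((-1 * r : ℤ) : Mat N) = C - (r + 1) • 1 := by
    rw [add_smul, one_smul, nsmul_one]
    push_cast
    rw [neg_one_mul]
    abel
  have hsign : Commute ((-1) ^ r) (T (monomialCurve x y a b z) * mpow z (C - (r + 1) • 1)) := by
    simp
  rw [eulerOp_neg_one, hexp, poch_sub_self, ← mul_assoc, ← hsign.eq, ← mul_assoc] at key
  exact key

end PowerRules

/-! ### Coefficients after a shift of the summation index -/

section PullOut

variable {r s : ℕ} {L L' R R' X X' Y Y' A A' : Mat N} {j k : ℤ} {S T : Series N}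

/-- The coefficient `X` is `Y` with factors `L` and `R` pulled out to the left and to the right. -/
def PullOut (L R X Y : Mat N) : Prop := X = L * Y * R

theorem PullOut.refl : PullOut 1 1 X X := by
  rw [PullOut, one_mul, mul_one]

theorem PullOut.mul (h : PullOut L R X Y) (h' : PullOut L' R' X' Y')
    (hR : Commute R L' := by simp)
    (hL' : Commute Y L' := by simp (maxDischargeDepth := 9) [*])
    (hR' : Commute R Y' := by simp (maxDischargeDepth := 9) [*]) :
    PullOut (L * L') (R * R') (X * X') (Y * Y') := by
  rw [PullOut, h, h']
  calc L * Y * R * (L' * Y' * R') = L * Y * (R * L') * Y' * R' := by simp only [mul_assoc]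
    _ = L * (Y * L') * (R * Y') * R' := by rw [hR.eq]; simp only [mul_assoc]
    _ = L * L' * (Y * Y') * (R * R') := by rw [hL'.eq, hR'.eq]; simp only [mul_assoc]

theorem PullOut.right (h : PullOut L 1 X Y) (hcomm : Commute L Y) : PullOut 1 L X Y := by
  rw [PullOut, h, mul_one, one_mul, hcomm.eq]

theorem PullOut.poch_left (s : ℤ)
    (h : 0 ≤ s ∧ 0 ≤ k ∨ NegReg A ∧ NegReg A' := by
      first | exact .inl (by omega) | exact .inr ⟨‹_›, ‹_›⟩)
    (hjk : j = k + s := by omega) (hA' : A' = A + (s : Mat N) := by simp [sub_eq_add_neg]) :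
    PullOut (poch A s) 1 (poch A j) (poch A' k) := by
  subst hjk hA'
  rw [PullOut, mul_one, poch_add (h.imp_right And.left) (h.imp And.right And.right)]

theorem PullOut.poch_right (s : ℤ)
    (h : 0 ≤ s ∧ 0 ≤ k ∨ NegReg A ∧ NegReg A' := by
      first | exact .inl (by omega) | exact .inr ⟨‹_›, ‹_›⟩)
    (hjk : j = k + s := by omega) (hA' : A' = A + (s : Mat N) := by simp [sub_eq_add_neg]) :
    PullOut 1 (poch A s) (poch A j) (poch A' k) :=
  (PullOut.poch_left s h hjk hA').right (by rw [hA']; simp (maxDischargeDepth := 9))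

theorem PullOut.poch_inv_right (s : ℤ) (hsk : 0 ≤ s ∧ 0 ≤ k := by omega)
    (hjk : j = k + s := by omega) (hA' : A' = A + (s : Mat N) := by simp) :
    PullOut 1 (poch A s)⁻¹ (poch A j)⁻¹ (poch A' k)⁻¹ := by
  rw [PullOut, PullOut.poch_left s (.inl hsk) hjk hA', mul_one, Matrix.mul_inv_rev, one_mul]

theorem PullOut.poch_neg_left (r : ℕ) (hA : NegReg A := by assumption)
    (hA' : NegReg (A - r • 1) := by assumption) (hjk : j = k - r := by omega) :
    PullOut ((-1) ^ r * (poch (1 - A) r)⁻¹) 1 (poch A j) (poch (A - r • 1) k) := by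
  rw [← poch_neg_natCast]
  exact PullOut.poch_left (-r) (.inr ⟨hA, hA'⟩)

theorem PullOut.poch_neg_right (r : ℕ) (hA : NegReg A := by assumption)
    (hA' : NegReg (A - r • 1) := by assumption) (hjk : j = k - r := by omega) :
    PullOut ((-1) ^ r) (poch (1 - A) r)⁻¹ (poch A j) (poch (A - r • 1) k) := by
  have h : PullOut 1 (poch A (-r)) (poch A j) (poch (A - r • 1) k) :=
    PullOut.poch_right (-r) (.inr ⟨hA, hA'⟩)
  have hsign : Commute ((-1) ^ r) (poch (A - r • 1) k) := by simp
  rw [PullOut, h, one_mul, poch_neg_natCast, ← mul_assoc, hsign.eq]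

theorem poch_mul_neg_one_pow (A : Mat N) (k : ℤ) (r : ℕ) :
    poch A k * (-1) ^ r = (-1) ^ r * poch A k :=
  ((Commute.neg_one_right _).pow_right r).eq

theorem DiffX.of_pullOut
    (h : S.regular → T.regular → ∀ m n : ℕ, PullOut L R (S.coeff (m + r) n) (T.coeff m n))
    (hL : L = L' := by simp only [one_mul, mul_one, ← mul_assoc, poch_mul_neg_one_pow])
    (hR : R = R' := by simp only [one_mul, mul_one]) : DiffX r S L' T R' :=
  hL ▸ hR ▸ .of_coeff h

theorem DiffY.of_pullOut
    (h : S.regular → T.regular → ∀ m n : ℕ, PullOut L R (S.coeff m (n + r)) (T.coeff m n))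
    (hL : L = L' := by simp only [one_mul, mul_one, ← mul_assoc, poch_mul_neg_one_pow])
    (hR : R = R' := by simp only [one_mul, mul_one]) : DiffY r S L' T R' :=
  hL ▸ hR ▸ .of_coeff h

end PullOut

/-! ### The individual functions -/

section Functions

variable {r : ℕ} {A A' B B' C C' C'' : Mat N} {x y : ℂ}

theorem G2.diffX (h : Commute B B') : DiffX r (G2 A A' B B') ((-1) ^ r * poch A r)
    (G2 (A + r • 1) A' (B - r • 1) (B' + r • 1)) ((poch (1 - B) r)⁻¹ * poch B' r) :=
  .of_pullOut fun ⟨_, _⟩ ⟨_, _⟩ _ _ =>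
    .mul (.mul (.mul (.poch_left r) .refl) (.poch_neg_right r)) (.poch_right r)

theorem G2.diffY (h₁ : Commute A A') (h₂ : Commute B B') : DiffY r (G2 A A' B B')
    ((-1) ^ r * poch A' r) (G2 A (A' + r • 1) (B + r • 1) (B' - r • 1))
    (poch B r * (poch (1 - B') r)⁻¹) :=
  .of_pullOut fun ⟨_, _⟩ ⟨_, _⟩ _ _ =>
    .mul (.mul (.mul .refl (.poch_left r)) (.poch_right r)) (.poch_neg_right r)

theorem G2.powLeft_A : PowLeft r A (G2 A A' B B') (G2 (A + r • 1) A' B B') fun x => (x, y) :=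
  .of_coeff 1 y 1 0 fun _ _ _ _ => .mul_const (.mul_const (.mul_const .poch_self))

theorem G2.powLeft_A' (h : Commute A A') :
    PowLeft r A' (G2 A A' B B') (G2 A (A' + r • 1) B B') fun y => (x, y) :=
  .of_coeff x 1 0 1 fun _ _ _ _ => .mul_const (.mul_const (.const_mul .poch_self))

theorem G2.powRight_B' :
    PowRight r B' (G2 A A' B B') (G2 A A' B (B' + r • 1)) fun x => (x, y / x) :=
  .of_coeff 1 y 1 (-1) fun ⟨_, _⟩ ⟨_, _⟩ _ _ => .const_mul .poch_self

theorem G2.powRight_B (h : Commute B B') :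
    PowRight r B (G2 A A' B B') (G2 A A' (B + r • 1) B') fun y => (x / y, y) :=
  .of_coeff x 1 (-1) 1 fun ⟨_, _⟩ ⟨_, _⟩ _ _ => .mul_const (.const_mul .poch_self)

theorem G3.diffX : DiffX r (G3 A A') ((-1) ^ r * (poch (1 - A) r)⁻¹)
    (G3 (A - r • 1) (A' + (2 * r) • 1)) (poch A' (2 * r)) :=
  .of_pullOut fun ⟨_, _⟩ ⟨_, _⟩ _ _ => .mul (.poch_neg_left r) (.poch_right (2 * r))

theorem G3.diffY : DiffY r (G3 A A') ((-1) ^ r * poch A (2 * r))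
    (G3 (A + (2 * r) • 1) (A' - r • 1)) (poch (1 - A') r)⁻¹ :=
  .of_pullOut fun ⟨_, _⟩ ⟨_, _⟩ _ _ => .mul (.poch_left (2 * r)) (.poch_neg_right r)

theorem G3.powRight_A' : PowRight r A' (G3 A A') (G3 A (A' + r • 1)) fun x => (x ^ 2, y / x) :=
  .of_coeff 1 y 2 (-1) fun ⟨_, _⟩ ⟨_, _⟩ _ _ => .const_mul .poch_self

theorem G3.powLeft_A : PowLeft r A (G3 A A') (G3 (A + r • 1) A') fun y => (x / y, y ^ 2) :=
  .of_coeff x 1 (-1) 2 fun ⟨_, _⟩ ⟨_, _⟩ _ _ => .mul_const .poch_self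

theorem H1.diffX (h : Commute A B) : DiffX r (H1 A B C C') (poch A r * poch B r)
    (H1 (A + r • 1) (B + r • 1) C (C' + r • 1)) (poch C' r)⁻¹ :=
  .of_pullOut fun ⟨_, _⟩ ⟨_, _⟩ _ _ =>
    .mul (.mul (.mul (.poch_left r) (.poch_left r)) .refl) (.poch_inv_right r)

theorem H1.diffY (h₁ : Commute A B) (h₂ : Commute C C') : DiffY r (H1 A B C C')
    ((-1) ^ r * (poch (1 - A) r)⁻¹ * poch B r) (H1 (A - r • 1) (B + r • 1) (C + r • 1) C')
    (poch C r) :=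
  .of_pullOut fun ⟨_, _⟩ ⟨_, _⟩ _ _ =>
    .mul (.mul (.mul (.poch_neg_left r) (.poch_left r)) (.poch_right r)) .refl

theorem H1.powLeft_A : PowLeft r A (H1 A B C C') (H1 (A + r • 1) B C C') fun x => (x, y / x) :=
  .of_coeff 1 y 1 (-1) fun ⟨_, _⟩ ⟨_, _⟩ _ _ => .mul_const (.mul_const (.mul_const .poch_self))

theorem H1.powLeft_B (h : Commute A B) :
    PowLeft r B (H1 A B C C') (H1 A (B + r • 1) C C') fun x => (x, y * x) :=
  .of_coeff 1 y 1 1 fun _ _ _ _ => .mul_const (.mul_const (.const_mul .poch_self))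

theorem H1.powRight_C (h : Commute C C') :
    PowRight r C (H1 A B C C') (H1 A B (C + r • 1) C') fun y => (x, y) :=
  .of_coeff x 1 0 1 fun _ _ _ _ => .mul_const (.const_mul .poch_self)

theorem H1.powLower_C' : PowLower r C' (H1 A B C C') (H1 A B C (C' - r • 1)) fun x => (x, y) :=
  .of_coeff 1 y 1 0 fun ⟨_, _⟩ ⟨_, _⟩ _ _ => .const_mul .poch_inv_self

theorem H2.diffX (h : Commute A B) : DiffX r (H2 A B C C' C'') (poch A r * poch B r)
    (H2 (A + r • 1) (B + r • 1) C C' (C'' + r • 1)) (poch C'' r)⁻¹ :=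
  .of_pullOut fun ⟨_, _⟩ ⟨_, _⟩ _ _ =>
    .mul (.mul (.mul (.mul (.poch_left r) (.poch_left r)) .refl) .refl) (.poch_inv_right r)

theorem H2.diffY (h₁ : Commute C C') (h₂ : Commute C C'') (h₃ : Commute C' C'') : DiffY r
    (H2 A B C C' C'') ((-1) ^ r * (poch (1 - A) r)⁻¹)
    (H2 (A - r • 1) B (C + r • 1) (C' + r • 1) C'') (poch C r * poch C' r) :=
  .of_pullOut fun ⟨_, _⟩ ⟨_, _⟩ _ _ =>
    .mul (.mul (.mul (.mul (.poch_neg_left r) .refl) (.poch_right r)) (.poch_right r)) .refl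

theorem H2.powLeft_A :
    PowLeft r A (H2 A B C C' C'') (H2 (A + r • 1) B C C' C'') fun x => (x, y / x) :=
  .of_coeff 1 y 1 (-1) fun ⟨_, _⟩ ⟨_, _⟩ _ _ =>
    .mul_const (.mul_const (.mul_const (.mul_const .poch_self)))

theorem H2.powLeft_B (h : Commute A B) :
    PowLeft r B (H2 A B C C' C'') (H2 A (B + r • 1) C C' C'') fun x => (x, y) :=
  .of_coeff 1 y 1 0 fun _ _ _ _ => .mul_const (.mul_const (.mul_const (.const_mul .poch_self)))

theorem H2.powRight_C (h₁ : Commute C C') (h₂ : Commute C C'') :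
    PowRight r C (H2 A B C C' C'') (H2 A B (C + r • 1) C' C'') fun y => (x, y) :=
  .of_coeff x 1 0 1 fun _ _ _ _ => .mul_const (.mul_const (.const_mul .poch_self))

theorem H2.powLower_C'' :
    PowLower r C'' (H2 A B C C' C'') (H2 A B C C' (C'' - r • 1)) fun x => (x, y) :=
  .of_coeff 1 y 1 0 fun ⟨_, _⟩ ⟨_, _⟩ _ _ => .const_mul .poch_inv_self

theorem H3.diffX :
    DiffX r (H3 A B C) (poch A (2 * r)) (H3 (A + (2 * r) • 1) B (C + r • 1)) (poch C r)⁻¹ :=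
  .of_pullOut fun _ _ _ _ => .mul (.mul (.poch_left (2 * r)) .refl) (.poch_inv_right r)

theorem H3.diffY (h : Commute B C) : DiffY r (H3 A B C) (poch A r)
    (H3 (A + r • 1) (B + r • 1) (C + r • 1)) (poch B r * (poch C r)⁻¹) :=
  .of_pullOut fun _ _ _ _ => .mul (.mul (.poch_left r) (.poch_right r)) (.poch_inv_right r)

theorem H3.powLeft_A : PowLeft r A (H3 A B C) (H3 (A + r • 1) B C) fun x => (x ^ 2, y * x) :=
  .of_coeff 1 y 2 1 fun _ _ _ _ => .mul_const (.mul_const .poch_self)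

theorem H3.powRight_B (h : Commute B C) :
    PowRight r B (H3 A B C) (H3 A (B + r • 1) C) fun y => (x, y) :=
  .of_coeff x 1 0 1 fun _ _ _ _ => .mul_const (.const_mul .poch_self)

theorem H3.powLower_C : PowLower r C (H3 A B C) (H3 A B (C - r • 1)) fun x => (x, x * y) :=
  .of_coeff 1 y 1 1 fun _ _ _ _ => .const_mul .poch_inv_self

theorem H4.diffX (h : Commute C C') :
    DiffX r (H4 A B C C') (poch A (2 * r)) (H4 (A + (2 * r) • 1) B (C + r • 1) C') (poch C r)⁻¹ :=
  .of_pullOut fun ⟨_, _⟩ ⟨_, _⟩ _ _ =>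
    .mul (.mul (.mul (.poch_left (2 * r)) .refl) (.poch_inv_right r)) .refl

theorem H4.diffY (h : Commute A B) : DiffY r (H4 A B C C') (poch A r * poch B r)
    (H4 (A + r • 1) (B + r • 1) C (C' + r • 1)) (poch C' r)⁻¹ :=
  .of_pullOut fun ⟨_, _⟩ ⟨_, _⟩ _ _ =>
    .mul (.mul (.mul (.poch_left r) (.poch_left r)) .refl) (.poch_inv_right r)

theorem H4.powLeft_A : PowLeft r A (H4 A B C C') (H4 (A + r • 1) B C C') fun x => (x ^ 2, y * x) :=
  .of_coeff 1 y 2 1 fun _ _ _ _ => .mul_const (.mul_const (.mul_const .poch_self))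

theorem H4.powLeft_B (h : Commute A B) :
    PowLeft r B (H4 A B C C') (H4 A (B + r • 1) C C') fun y => (x, y) :=
  .of_coeff x 1 0 1 fun _ _ _ _ => .mul_const (.mul_const (.const_mul .poch_self))

theorem H4.powLower_C (h : Commute C C') :
    PowLower r C (H4 A B C C') (H4 A B (C - r • 1) C') fun x => (x, y) :=
  .of_coeff 1 y 1 0 fun ⟨_, _⟩ ⟨_, _⟩ _ _ => .mul_const (.const_mul .poch_inv_self)

theorem H4.powLower_C' : PowLower r C' (H4 A B C C') (H4 A B C (C' - r • 1)) fun y => (x, y) :=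
  .of_coeff x 1 0 1 fun ⟨_, _⟩ ⟨_, _⟩ _ _ => .const_mul .poch_inv_self

theorem H5.diffX (h : Commute A B) : DiffX r (H5 A B C)
    ((-1) ^ r * poch A (2 * r) * (poch (1 - B) r)⁻¹) (H5 (A + (2 * r) • 1) (B - r • 1) C) 1 :=
  .of_pullOut fun ⟨_, _⟩ ⟨_, _⟩ _ _ => .mul (.mul (.poch_left (2 * r)) (.poch_neg_left r)) .refl

theorem H5.diffY (h : Commute A B) : DiffY r (H5 A B C) (poch A r * poch B r)
    (H5 (A + r • 1) (B + r • 1) (C + r • 1)) (poch C r)⁻¹ :=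
  .of_pullOut fun ⟨_, _⟩ ⟨_, _⟩ _ _ => .mul (.mul (.poch_left r) (.poch_left r)) (.poch_inv_right r)

theorem H5.powLeft_A : PowLeft r A (H5 A B C) (H5 (A + r • 1) B C) fun x => (x ^ 2, y * x) :=
  .of_coeff 1 y 2 1 fun _ _ _ _ => .mul_const (.mul_const .poch_self)

theorem H5.powLeft_B (h : Commute A B) :
    PowLeft r B (H5 A B C) (H5 A (B + r • 1) C) fun y => (x / y, y) :=
  .of_coeff x 1 (-1) 1 fun ⟨_, _⟩ ⟨_, _⟩ _ _ => .mul_const (.const_mul .poch_self)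

theorem H5.powLower_C : PowLower r C (H5 A B C) (H5 A B (C - r • 1)) fun y => (x, y) :=
  .of_coeff x 1 0 1 fun ⟨_, _⟩ ⟨_, _⟩ _ _ => .const_mul .poch_inv_self

theorem H6.diffX (h : Commute A B) : DiffX r (H6 A B C)
    ((-1) ^ r * poch A (2 * r) * (poch (1 - B) r)⁻¹) (H6 (A + (2 * r) • 1) (B - r • 1) C) 1 :=
  .of_pullOut fun ⟨_, _⟩ ⟨_, _⟩ _ _ => .mul (.mul (.poch_left (2 * r)) (.poch_neg_left r)) .refl

theorem H6.diffY (h : Commute A B) : DiffY r (H6 A B C)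
    ((-1) ^ r * (poch (1 - A) r)⁻¹ * poch B r) (H6 (A - r • 1) (B + r • 1) (C + r • 1))
    (poch C r) :=
  .of_pullOut fun ⟨_, _⟩ ⟨_, _⟩ _ _ => .mul (.mul (.poch_neg_left r) (.poch_left r)) (.poch_right r)

theorem H6.powLeft_A : PowLeft r A (H6 A B C) (H6 (A + r • 1) B C) fun x => (x ^ 2, y / x) :=
  .of_coeff 1 y 2 (-1) fun ⟨_, _⟩ ⟨_, _⟩ _ _ => .mul_const (.mul_const .poch_self)

theorem H6.powLeft_B (h : Commute A B) :
    PowLeft r B (H6 A B C) (H6 A (B + r • 1) C) fun y => (x / y, y) :=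
  .of_coeff x 1 (-1) 1 fun ⟨_, _⟩ ⟨_, _⟩ _ _ => .mul_const (.const_mul .poch_self)

theorem H6.powRight_C : PowRight r C (H6 A B C) (H6 A B (C + r • 1)) fun y => (x, y) :=
  .of_coeff x 1 0 1 fun _ _ _ _ => .const_mul .poch_self

theorem H7.diffX :
    DiffX r (H7 A B C C') (poch A (2 * r)) (H7 (A + (2 * r) • 1) B C (C' + r • 1)) (poch C' r)⁻¹ :=
  .of_pullOut fun ⟨_, _⟩ ⟨_, _⟩ _ _ =>
    .mul (.mul (.mul (.poch_left (2 * r)) .refl) .refl) (.poch_inv_right r)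

theorem H7.diffY (h₁ : Commute A B) (h₂ : Commute C C') : DiffY r (H7 A B C C')
    ((-1) ^ r * (poch (1 - A) r)⁻¹ * poch B r) (H7 (A - r • 1) (B + r • 1) (C + r • 1) C')
    (poch C r) :=
  .of_pullOut fun ⟨_, _⟩ ⟨_, _⟩ _ _ =>
    .mul (.mul (.mul (.poch_neg_left r) (.poch_left r)) (.poch_right r)) .refl

theorem H7.powLeft_A : PowLeft r A (H7 A B C C') (H7 (A + r • 1) B C C') fun x => (x ^ 2, y / x) :=
  .of_coeff 1 y 2 (-1) fun ⟨_, _⟩ ⟨_, _⟩ _ _ => .mul_const (.mul_const (.mul_const .poch_self))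

theorem H7.powLeft_B (h : Commute A B) :
    PowLeft r B (H7 A B C C') (H7 A (B + r • 1) C C') fun y => (x, y) :=
  .of_coeff x 1 0 1 fun _ _ _ _ => .mul_const (.mul_const (.const_mul .poch_self))

theorem H7.powRight_C (h : Commute C C') :
    PowRight r C (H7 A B C C') (H7 A B (C + r • 1) C') fun y => (x, y) :=
  .of_coeff x 1 0 1 fun _ _ _ _ => .mul_const (.const_mul .poch_self)

theorem H7.powLower_C' : PowLower r C' (H7 A B C C') (H7 A B C (C' - r • 1)) fun x => (x, y) :=
  .of_coeff 1 y 1 0 fun ⟨_, _⟩ ⟨_, _⟩ _ _ => .const_mul .poch_inv_self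

theorem Γ1.diffX (h : Commute B B') : DiffX r (Γ1 A B B') ((-1) ^ r * poch A r)
    (Γ1 (A + r • 1) (B - r • 1) (B' + r • 1)) ((poch (1 - B) r)⁻¹ * poch B' r) :=
  .of_pullOut fun ⟨_, _⟩ ⟨_, _⟩ _ _ =>
    .mul (.mul (.poch_left r) (.poch_neg_right r)) (.poch_right r)

theorem Γ1.diffY (h : Commute B B') : DiffY r (Γ1 A B B') ((-1) ^ r)
    (Γ1 A (B + r • 1) (B' - r • 1)) (poch B r * (poch (1 - B') r)⁻¹) :=
  .of_pullOut fun ⟨_, _⟩ ⟨_, _⟩ _ _ => .mul (.mul .refl (.poch_right r)) (.poch_neg_right r)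

theorem Γ1.powLeft_A : PowLeft r A (Γ1 A B B') (Γ1 (A + r • 1) B B') fun x => (x, y) :=
  .of_coeff 1 y 1 0 fun _ _ _ _ => .mul_const (.mul_const .poch_self)

theorem Γ1.powRight_B' : PowRight r B' (Γ1 A B B') (Γ1 A B (B' + r • 1)) fun x => (x, y / x) :=
  .of_coeff 1 y 1 (-1) fun ⟨_, _⟩ ⟨_, _⟩ _ _ => .const_mul .poch_self

theorem Γ1.powRight_B (h : Commute B B') :
    PowRight r B (Γ1 A B B') (Γ1 A (B + r • 1) B') fun y => (x / y, y) :=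
  .of_coeff x 1 (-1) 1 fun ⟨_, _⟩ ⟨_, _⟩ _ _ => .mul_const (.const_mul .poch_self)

theorem Γ2.diffX :
    DiffX r (Γ2 B B') ((-1) ^ r * (poch (1 - B) r)⁻¹) (Γ2 (B - r • 1) (B' + r • 1)) (poch B' r) :=
  .of_pullOut fun ⟨_, _⟩ ⟨_, _⟩ _ _ => .mul (.poch_neg_left r) (.poch_right r)

theorem Γ2.diffY :
    DiffY r (Γ2 B B') ((-1) ^ r * poch B r) (Γ2 (B + r • 1) (B' - r • 1)) (poch (1 - B') r)⁻¹ :=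
  .of_pullOut fun ⟨_, _⟩ ⟨_, _⟩ _ _ => .mul (.poch_left r) (.poch_neg_right r)

theorem Γ2.powRight_B' : PowRight r B' (Γ2 B B') (Γ2 B (B' + r • 1)) fun x => (x, y / x) :=
  .of_coeff 1 y 1 (-1) fun ⟨_, _⟩ ⟨_, _⟩ _ _ => .const_mul .poch_self

theorem Γ2.powLeft_B : PowLeft r B (Γ2 B B') (Γ2 (B + r • 1) B') fun y => (x / y, y) :=
  .of_coeff x 1 (-1) 1 fun ⟨_, _⟩ ⟨_, _⟩ _ _ => .mul_const .poch_self

theorem Γ2.powRight_B (h : Commute B B') :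
    PowRight r B (Γ2 B B') (Γ2 (B + r • 1) B') fun y => (x / y, y) :=
  .of_coeff x 1 (-1) 1 fun ⟨_, _⟩ ⟨_, _⟩ _ _ => .mul_const .poch_self

theorem ℋ1.diffX (h : Commute A B) : DiffX r (ℋ1 A B C) (poch A r * poch B r)
    (ℋ1 (A + r • 1) (B + r • 1) (C + r • 1)) (poch C r)⁻¹ :=
  .of_pullOut fun ⟨_, _⟩ ⟨_, _⟩ _ _ => .mul (.mul (.poch_left r) (.poch_left r)) (.poch_inv_right r)

theorem ℋ1.diffY (h : Commute A B) : DiffY r (ℋ1 A B C)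
    ((-1) ^ r * (poch (1 - A) r)⁻¹ * poch B r) (ℋ1 (A - r • 1) (B + r • 1) C) 1 :=
  .of_pullOut fun ⟨_, _⟩ ⟨_, _⟩ _ _ => .mul (.mul (.poch_neg_left r) (.poch_left r)) .refl

theorem ℋ1.powLeft_A : PowLeft r A (ℋ1 A B C) (ℋ1 (A + r • 1) B C) fun x => (x, y / x) :=
  .of_coeff 1 y 1 (-1) fun ⟨_, _⟩ ⟨_, _⟩ _ _ => .mul_const (.mul_const .poch_self)

theorem ℋ1.powLeft_B (h : Commute A B) :
    PowLeft r B (ℋ1 A B C) (ℋ1 A (B + r • 1) C) fun x => (x, y * x) :=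
  .of_coeff 1 y 1 1 fun _ _ _ _ => .mul_const (.const_mul .poch_self)

theorem ℋ1.powLower_C : PowLower r C (ℋ1 A B C) (ℋ1 A B (C - r • 1)) fun x => (x, y) :=
  .of_coeff 1 y 1 0 fun ⟨_, _⟩ ⟨_, _⟩ _ _ => .const_mul .poch_inv_self

theorem ℋ2.diffX (h : Commute A B) : DiffX r (ℋ2 A B B' C) (poch A r * poch B r)
    (ℋ2 (A + r • 1) (B + r • 1) B' (C + r • 1)) (poch C r)⁻¹ :=
  .of_pullOut fun ⟨_, _⟩ ⟨_, _⟩ _ _ =>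
    .mul (.mul (.mul (.poch_left r) (.poch_left r)) .refl) (.poch_inv_right r)

theorem ℋ2.diffY (h : Commute B' C) : DiffY r (ℋ2 A B B' C) ((-1) ^ r * (poch (1 - A) r)⁻¹)
    (ℋ2 (A - r • 1) B (B' + r • 1) C) (poch B' r) :=
  .of_pullOut fun ⟨_, _⟩ ⟨_, _⟩ _ _ =>
    .mul (.mul (.mul (.poch_neg_left r) .refl) (.poch_right r)) .refl

theorem ℋ2.powLeft_A : PowLeft r A (ℋ2 A B B' C) (ℋ2 (A + r • 1) B B' C) fun x => (x, y / x) :=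
  .of_coeff 1 y 1 (-1) fun ⟨_, _⟩ ⟨_, _⟩ _ _ => .mul_const (.mul_const (.mul_const .poch_self))

theorem ℋ2.powLeft_B (h : Commute A B) :
    PowLeft r B (ℋ2 A B B' C) (ℋ2 A (B + r • 1) B' C) fun x => (x, y) :=
  .of_coeff 1 y 1 0 fun _ _ _ _ => .mul_const (.mul_const (.const_mul .poch_self))

theorem ℋ2.powRight_B' (h : Commute B' C) :
    PowRight r B' (ℋ2 A B B' C) (ℋ2 A B (B' + r • 1) C) fun y => (x, y) :=
  .of_coeff x 1 0 1 fun _ _ _ _ => .mul_const (.const_mul .poch_self)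

theorem ℋ2.powLower_C : PowLower r C (ℋ2 A B B' C) (ℋ2 A B B' (C - r • 1)) fun x => (x, y) :=
  .of_coeff 1 y 1 0 fun ⟨_, _⟩ ⟨_, _⟩ _ _ => .const_mul .poch_inv_self

theorem ℋ3.diffX (h : Commute B C) : DiffX r (ℋ3 A B C) (poch A r)
    (ℋ3 (A + r • 1) (B + r • 1) (C + r • 1)) (poch B r * (poch C r)⁻¹) :=
  .of_pullOut fun ⟨_, _⟩ ⟨_, _⟩ _ _ =>
    .mul (.mul (.poch_left r) (.poch_right r)) (.poch_inv_right r)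

theorem ℋ3.diffY : DiffY r (ℋ3 A B C) ((-1) ^ r * (poch (1 - A) r)⁻¹) (ℋ3 (A - r • 1) B C) 1 :=
  .of_pullOut fun ⟨_, _⟩ ⟨_, _⟩ _ _ => .mul (.mul (.poch_neg_left r) .refl) .refl

theorem ℋ3.powLeft_A : PowLeft r A (ℋ3 A B C) (ℋ3 (A + r • 1) B C) fun x => (x, y / x) :=
  .of_coeff 1 y 1 (-1) fun ⟨_, _⟩ ⟨_, _⟩ _ _ => .mul_const (.mul_const .poch_self)

theorem ℋ3.powRight_B (h : Commute B C) :
    PowRight r B (ℋ3 A B C) (ℋ3 A (B + r • 1) C) fun x => (x, y) :=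
  .of_coeff 1 y 1 0 fun _ _ _ _ => .mul_const (.const_mul .poch_self)

theorem ℋ3.powLower_C : PowLower r C (ℋ3 A B C) (ℋ3 A B (C - r • 1)) fun x => (x, y) :=
  .of_coeff 1 y 1 0 fun ⟨_, _⟩ ⟨_, _⟩ _ _ => .const_mul .poch_inv_self

theorem ℋ4.diffX : DiffX r (ℋ4 A B' C) (poch A r) (ℋ4 (A + r • 1) B' (C + r • 1)) (poch C r)⁻¹ :=
  .of_pullOut fun ⟨_, _⟩ ⟨_, _⟩ _ _ => .mul (.mul (.poch_left r) .refl) (.poch_inv_right r)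

theorem ℋ4.diffY (h : Commute B' C) : DiffY r (ℋ4 A B' C) ((-1) ^ r * (poch (1 - A) r)⁻¹)
    (ℋ4 (A - r • 1) (B' + r • 1) C) (poch B' r) :=
  .of_pullOut fun ⟨_, _⟩ ⟨_, _⟩ _ _ => .mul (.mul (.poch_neg_left r) (.poch_right r)) .refl

theorem ℋ4.powLeft_A : PowLeft r A (ℋ4 A B' C) (ℋ4 (A + r • 1) B' C) fun x => (x, y / x) :=
  .of_coeff 1 y 1 (-1) fun ⟨_, _⟩ ⟨_, _⟩ _ _ => .mul_const (.mul_const .poch_self)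

theorem ℋ4.powRight_B' (h : Commute B' C) :
    PowRight r B' (ℋ4 A B' C) (ℋ4 A (B' + r • 1) C) fun y => (x, y) :=
  .of_coeff x 1 0 1 fun _ _ _ _ => .mul_const (.const_mul .poch_self)

theorem ℋ4.powLower_C : PowLower r C (ℋ4 A B' C) (ℋ4 A B' (C - r • 1)) fun x => (x, y) :=
  .of_coeff 1 y 1 0 fun ⟨_, _⟩ ⟨_, _⟩ _ _ => .const_mul .poch_inv_self

theorem ℋ5.diffX : DiffX r (ℋ5 A C) (poch A r) (ℋ5 (A + r • 1) (C + r • 1)) (poch C r)⁻¹ :=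
  .of_pullOut fun ⟨_, _⟩ ⟨_, _⟩ _ _ => .mul (.poch_left r) (.poch_inv_right r)

theorem ℋ5.diffY : DiffY r (ℋ5 A C) ((-1) ^ r * (poch (1 - A) r)⁻¹) (ℋ5 (A - r • 1) C) 1 :=
  .of_pullOut fun ⟨_, _⟩ ⟨_, _⟩ _ _ => .mul (.poch_neg_left r) .refl

theorem ℋ5.powLeft_A : PowLeft r A (ℋ5 A C) (ℋ5 (A + r • 1) C) fun x => (x, y / x) :=
  .of_coeff 1 y 1 (-1) fun ⟨_, _⟩ ⟨_, _⟩ _ _ => .mul_const .poch_self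

theorem ℋ5.powLower_C : PowLower r C (ℋ5 A C) (ℋ5 A (C - r • 1)) fun x => (x, y) :=
  .of_coeff 1 y 1 0 fun ⟨_, _⟩ ⟨_, _⟩ _ _ => .const_mul .poch_inv_self

theorem ℋ6.diffX :
    DiffX r (ℋ6 A C) (poch A (2 * r)) (ℋ6 (A + (2 * r) • 1) (C + r • 1)) (poch C r)⁻¹ :=
  .of_pullOut fun _ _ _ _ => .mul (.poch_left (2 * r)) (.poch_inv_right r)

theorem ℋ6.diffY : DiffY r (ℋ6 A C) (poch A r) (ℋ6 (A + r • 1) (C + r • 1)) (poch C r)⁻¹ :=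
  .of_pullOut fun _ _ _ _ => .mul (.poch_left r) (.poch_inv_right r)

theorem ℋ6.powLeft_A : PowLeft r A (ℋ6 A C) (ℋ6 (A + r • 1) C) fun x => (x ^ 2, y * x) :=
  .of_coeff 1 y 2 1 fun _ _ _ _ => .mul_const .poch_self

theorem ℋ6.powLower_C : PowLower r C (ℋ6 A C) (ℋ6 A (C - r • 1)) fun x => (x, x * y) :=
  .of_coeff 1 y 1 1 fun _ _ _ _ => .const_mul .poch_inv_self

theorem ℋ7.diffX (h : Commute C C') :
    DiffX r (ℋ7 A C C') (poch A (2 * r)) (ℋ7 (A + (2 * r) • 1) (C + r • 1) C') (poch C r)⁻¹ :=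
  .of_pullOut fun ⟨_, _⟩ ⟨_, _⟩ _ _ => .mul (.mul (.poch_left (2 * r)) (.poch_inv_right r)) .refl

theorem ℋ7.diffY : DiffY r (ℋ7 A C C') (poch A r) (ℋ7 (A + r • 1) C (C' + r • 1)) (poch C' r)⁻¹ :=
  .of_pullOut fun ⟨_, _⟩ ⟨_, _⟩ _ _ => .mul (.mul (.poch_left r) .refl) (.poch_inv_right r)

theorem ℋ7.powLeft_A : PowLeft r A (ℋ7 A C C') (ℋ7 (A + r • 1) C C') fun x => (x ^ 2, y * x) :=
  .of_coeff 1 y 2 1 fun _ _ _ _ => .mul_const (.mul_const .poch_self)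

theorem ℋ7.powLower_C (h : Commute C C') :
    PowLower r C (ℋ7 A C C') (ℋ7 A (C - r • 1) C') fun x => (x, y) :=
  .of_coeff 1 y 1 0 fun ⟨_, _⟩ ⟨_, _⟩ _ _ => .mul_const (.const_mul .poch_inv_self)

theorem ℋ7.powLower_C' : PowLower r C' (ℋ7 A C C') (ℋ7 A C (C' - r • 1)) fun y => (x, y) :=
  .of_coeff x 1 0 1 fun ⟨_, _⟩ ⟨_, _⟩ _ _ => .const_mul .poch_inv_self

theorem ℋ8.diffX : DiffX r (ℋ8 A B) ((-1) ^ r * poch A (2 * r))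
    (ℋ8 (A + (2 * r) • 1) (B - r • 1)) (poch (1 - B) r)⁻¹ :=
  .of_pullOut fun ⟨_, _⟩ ⟨_, _⟩ _ _ => .mul (.poch_left (2 * r)) (.poch_neg_right r)

theorem ℋ8.diffY :
    DiffY r (ℋ8 A B) ((-1) ^ r * (poch (1 - A) r)⁻¹) (ℋ8 (A - r • 1) (B + r • 1)) (poch B r) :=
  .of_pullOut fun ⟨_, _⟩ ⟨_, _⟩ _ _ => .mul (.poch_neg_left r) (.poch_right r)

theorem ℋ8.powLeft_A : PowLeft r A (ℋ8 A B) (ℋ8 (A + r • 1) B) fun x => (x ^ 2, y / x) :=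
  .of_coeff 1 y 2 (-1) fun ⟨_, _⟩ ⟨_, _⟩ _ _ => .mul_const .poch_self

theorem ℋ8.powRight_B : PowRight r B (ℋ8 A B) (ℋ8 A (B + r • 1)) fun y => (x / y, y) :=
  .of_coeff x 1 (-1) 1 fun ⟨_, _⟩ ⟨_, _⟩ _ _ => .const_mul .poch_self

theorem ℋ9.diffX :
    DiffX r (ℋ9 A B C) (poch A (2 * r)) (ℋ9 (A + (2 * r) • 1) B (C + r • 1)) (poch C r)⁻¹ :=
  .of_pullOut fun ⟨_, _⟩ ⟨_, _⟩ _ _ => .mul (.mul (.poch_left (2 * r)) .refl) (.poch_inv_right r)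

theorem ℋ9.diffY (h : Commute B C) :
    DiffY r (ℋ9 A B C) ((-1) ^ r * (poch (1 - A) r)⁻¹) (ℋ9 (A - r • 1) (B + r • 1) C) (poch B r) :=
  .of_pullOut fun ⟨_, _⟩ ⟨_, _⟩ _ _ => .mul (.mul (.poch_neg_left r) (.poch_right r)) .refl

theorem ℋ9.powLeft_A : PowLeft r A (ℋ9 A B C) (ℋ9 (A + r • 1) B C) fun x => (x ^ 2, y / x) :=
  .of_coeff 1 y 2 (-1) fun ⟨_, _⟩ ⟨_, _⟩ _ _ => .mul_const (.mul_const .poch_self)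

theorem ℋ9.powRight_B (h : Commute B C) :
    PowRight r B (ℋ9 A B C) (ℋ9 A (B + r • 1) C) fun y => (x, y) :=
  .of_coeff x 1 0 1 fun _ _ _ _ => .mul_const (.const_mul .poch_self)

theorem ℋ9.powLower_C : PowLower r C (ℋ9 A B C) (ℋ9 A B (C - r • 1)) fun x => (x, y) :=
  .of_coeff 1 y 1 0 fun ⟨_, _⟩ ⟨_, _⟩ _ _ => .const_mul .poch_inv_self

theorem ℋ10.diffX :
    DiffX r (ℋ10 A C) (poch A (2 * r)) (ℋ10 (A + (2 * r) • 1) (C + r • 1)) (poch C r)⁻¹ :=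
  .of_pullOut fun ⟨_, _⟩ ⟨_, _⟩ _ _ => .mul (.poch_left (2 * r)) (.poch_inv_right r)

theorem ℋ10.diffY : DiffY r (ℋ10 A C) ((-1) ^ r * (poch (1 - A) r)⁻¹) (ℋ10 (A - r • 1) C) 1 :=
  .of_pullOut fun ⟨_, _⟩ ⟨_, _⟩ _ _ => .mul (.poch_neg_left r) .refl

theorem ℋ10.powLeft_A : PowLeft r A (ℋ10 A C) (ℋ10 (A + r • 1) C) fun x => (x ^ 2, y / x) :=
  .of_coeff 1 y 2 (-1) fun ⟨_, _⟩ ⟨_, _⟩ _ _ => .mul_const .poch_self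

theorem ℋ10.powLower_C : PowLower r C (ℋ10 A C) (ℋ10 A (C - r • 1)) fun x => (x, y) :=
  .of_coeff 1 y 1 0 fun ⟨_, _⟩ ⟨_, _⟩ _ _ => .const_mul .poch_inv_self

theorem ℋ11.diffX :
    DiffX r (ℋ11 A B C C') (poch A r) (ℋ11 (A + r • 1) B C (C' + r • 1)) (poch C' r)⁻¹ :=
  .of_pullOut fun ⟨_, _⟩ ⟨_, _⟩ _ _ =>
    .mul (.mul (.mul (.poch_left r) .refl) .refl) (.poch_inv_right r)

theorem ℋ11.diffY (h₁ : Commute A B) (h₂ : Commute C C') : DiffY r (ℋ11 A B C C')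
    ((-1) ^ r * (poch (1 - A) r)⁻¹ * poch B r) (ℋ11 (A - r • 1) (B + r • 1) (C + r • 1) C')
    (poch C r) :=
  .of_pullOut fun ⟨_, _⟩ ⟨_, _⟩ _ _ =>
    .mul (.mul (.mul (.poch_neg_left r) (.poch_left r)) (.poch_right r)) .refl

theorem ℋ11.powLeft_A : PowLeft r A (ℋ11 A B C C') (ℋ11 (A + r • 1) B C C') fun x => (x, y / x) :=
  .of_coeff 1 y 1 (-1) fun ⟨_, _⟩ ⟨_, _⟩ _ _ => .mul_const (.mul_const (.mul_const .poch_self))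

theorem ℋ11.powLeft_B (h : Commute A B) :
    PowLeft r B (ℋ11 A B C C') (ℋ11 A (B + r • 1) C C') fun y => (x, y) :=
  .of_coeff x 1 0 1 fun _ _ _ _ => .mul_const (.mul_const (.const_mul .poch_self))

theorem ℋ11.powLower_C' : PowLower r C' (ℋ11 A B C C') (ℋ11 A B C (C' - r • 1)) fun x => (x, y) :=
  .of_coeff 1 y 1 0 fun ⟨_, _⟩ ⟨_, _⟩ _ _ => .const_mul .poch_inv_self

end Functions

end HornMatrix

theorem mainTheorem8 {N : ℕ} (r : ℕ) (A A' B B' C C' C'' : Mat N) (x y : ℂ) :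
    -- Horn function `G₂`
    ((Commute B B' → DiffX r (G2 A A' B B') ((-1) ^ r * poch A r)
        (G2 (A + r • 1) A' (B - r • 1) (B' + r • 1)) ((poch (1 - B) r)⁻¹ * poch B' r)) ∧
      (Commute A A' → Commute B B' → DiffY r (G2 A A' B B') ((-1) ^ r * poch A' r)
        (G2 A (A' + r • 1) (B + r • 1) (B' - r • 1)) (poch B r * (poch (1 - B') r)⁻¹)) ∧
      (PowLeft r A (G2 A A' B B') (G2 (A + r • 1) A' B B') fun x => (x, y)) ∧
      (Commute A A' → PowLeft r A' (G2 A A' B B') (G2 A (A' + r • 1) B B') fun y => (x, y)) ∧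
      (PowRight r B' (G2 A A' B B') (G2 A A' B (B' + r • 1)) fun x => (x, y / x)) ∧
      (Commute B B' → PowRight r B (G2 A A' B B') (G2 A A' (B + r • 1) B') fun y => (x / y, y))) ∧
    -- Horn function `G₃`
    ((DiffX r (G3 A A') ((-1) ^ r * (poch (1 - A) r)⁻¹)
        (G3 (A - r • 1) (A' + (2 * r) • 1)) (poch A' (2 * r))) ∧
      (DiffY r (G3 A A') ((-1) ^ r * poch A (2 * r))
        (G3 (A + (2 * r) • 1) (A' - r • 1)) (poch (1 - A') r)⁻¹) ∧
      (PowRight r A' (G3 A A') (G3 A (A' + r • 1)) fun x => (x ^ 2, y / x)) ∧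
      (PowLeft r A (G3 A A') (G3 (A + r • 1) A') fun y => (x / y, y ^ 2))) ∧
    -- Horn function `H₁`
    ((Commute A B → DiffX r (H1 A B C C') (poch A r * poch B r)
        (H1 (A + r • 1) (B + r • 1) C (C' + r • 1)) (poch C' r)⁻¹) ∧
      (Commute A B → Commute C C' → DiffY r (H1 A B C C') ((-1) ^ r * (poch (1 - A) r)⁻¹ * poch B r)
        (H1 (A - r • 1) (B + r • 1) (C + r • 1) C') (poch C r)) ∧
      (PowLeft r A (H1 A B C C') (H1 (A + r • 1) B C C') fun x => (x, y / x)) ∧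
      (Commute A B → PowLeft r B (H1 A B C C') (H1 A (B + r • 1) C C') fun x => (x, y * x)) ∧
      (Commute C C' → PowRight r C (H1 A B C C') (H1 A B (C + r • 1) C') fun y => (x, y)) ∧
      (PowLower r C' (H1 A B C C') (H1 A B C (C' - r • 1)) fun x => (x, y))) ∧
    -- Horn function `H₂`
    ((Commute A B → DiffX r (H2 A B C C' C'') (poch A r * poch B r)
        (H2 (A + r • 1) (B + r • 1) C C' (C'' + r • 1)) (poch C'' r)⁻¹) ∧
      (Commute C C' → Commute C C'' → Commute C' C'' → DiffY r (H2 A B C C' C'') ((-1) ^ r * (poch (1 - A) r)⁻¹)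
        (H2 (A - r • 1) B (C + r • 1) (C' + r • 1) C'') (poch C r * poch C' r)) ∧
      (PowLeft r A (H2 A B C C' C'') (H2 (A + r • 1) B C C' C'') fun x => (x, y / x)) ∧
      (Commute A B → PowLeft r B (H2 A B C C' C'') (H2 A (B + r • 1) C C' C'') fun x => (x, y)) ∧
      (Commute C C' → Commute C C'' → PowRight r C (H2 A B C C' C'')
        (H2 A B (C + r • 1) C' C'') fun y => (x, y)) ∧
      (PowLower r C'' (H2 A B C C' C'') (H2 A B C C' (C'' - r • 1)) fun x => (x, y))) ∧
    -- Horn function `H₃`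
    ((DiffX r (H3 A B C) (poch A (2 * r)) (H3 (A + (2 * r) • 1) B (C + r • 1)) (poch C r)⁻¹) ∧
      (Commute B C → DiffY r (H3 A B C) (poch A r)
        (H3 (A + r • 1) (B + r • 1) (C + r • 1)) (poch B r * (poch C r)⁻¹)) ∧
      (PowLeft r A (H3 A B C) (H3 (A + r • 1) B C) fun x => (x ^ 2, y * x)) ∧
      (Commute B C → PowRight r B (H3 A B C) (H3 A (B + r • 1) C) fun y => (x, y)) ∧
      (PowLower r C (H3 A B C) (H3 A B (C - r • 1)) fun x => (x, x * y))) ∧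
    -- Horn function `H₄`
    ((Commute C C' → DiffX r (H4 A B C C') (poch A (2 * r))
        (H4 (A + (2 * r) • 1) B (C + r • 1) C') (poch C r)⁻¹) ∧
      (Commute A B → DiffY r (H4 A B C C') (poch A r * poch B r)
        (H4 (A + r • 1) (B + r • 1) C (C' + r • 1)) (poch C' r)⁻¹) ∧
      (PowLeft r A (H4 A B C C') (H4 (A + r • 1) B C C') fun x => (x ^ 2, y * x)) ∧
      (Commute A B → PowLeft r B (H4 A B C C') (H4 A (B + r • 1) C C') fun y => (x, y)) ∧
      (Commute C C' → PowLower r C (H4 A B C C') (H4 A B (C - r • 1) C') fun x => (x, y)) ∧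
      (PowLower r C' (H4 A B C C') (H4 A B C (C' - r • 1)) fun y => (x, y))) ∧
    -- Horn function `H₅`
    ((Commute A B → DiffX r (H5 A B C) ((-1) ^ r * poch A (2 * r) * (poch (1 - B) r)⁻¹)
        (H5 (A + (2 * r) • 1) (B - r • 1) C) 1) ∧
      (Commute A B → DiffY r (H5 A B C) (poch A r * poch B r)
        (H5 (A + r • 1) (B + r • 1) (C + r • 1)) (poch C r)⁻¹) ∧
      (PowLeft r A (H5 A B C) (H5 (A + r • 1) B C) fun x => (x ^ 2, y * x)) ∧
      (Commute A B → PowLeft r B (H5 A B C) (H5 A (B + r • 1) C) fun y => (x / y, y)) ∧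
      (PowLower r C (H5 A B C) (H5 A B (C - r • 1)) fun y => (x, y))) ∧
    -- Horn function `H₆`
    ((Commute A B → DiffX r (H6 A B C) ((-1) ^ r * poch A (2 * r) * (poch (1 - B) r)⁻¹)
        (H6 (A + (2 * r) • 1) (B - r • 1) C) 1) ∧
      (Commute A B → DiffY r (H6 A B C) ((-1) ^ r * (poch (1 - A) r)⁻¹ * poch B r)
        (H6 (A - r • 1) (B + r • 1) (C + r • 1)) (poch C r)) ∧
      (PowLeft r A (H6 A B C) (H6 (A + r • 1) B C) fun x => (x ^ 2, y / x)) ∧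
      (Commute A B → PowLeft r B (H6 A B C) (H6 A (B + r • 1) C) fun y => (x / y, y)) ∧
      (PowRight r C (H6 A B C) (H6 A B (C + r • 1)) fun y => (x, y))) ∧
    -- Horn function `H₇`
    ((DiffX r (H7 A B C C') (poch A (2 * r))
        (H7 (A + (2 * r) • 1) B C (C' + r • 1)) (poch C' r)⁻¹) ∧
      (Commute A B → Commute C C' → DiffY r (H7 A B C C') ((-1) ^ r * (poch (1 - A) r)⁻¹ * poch B r)
        (H7 (A - r • 1) (B + r • 1) (C + r • 1) C') (poch C r)) ∧
      (PowLeft r A (H7 A B C C') (H7 (A + r • 1) B C C') fun x => (x ^ 2, y / x)) ∧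
      (Commute A B → PowLeft r B (H7 A B C C') (H7 A (B + r • 1) C C') fun y => (x, y)) ∧
      (Commute C C' → PowRight r C (H7 A B C C') (H7 A B (C + r • 1) C') fun y => (x, y)) ∧
      (PowLower r C' (H7 A B C C') (H7 A B C (C' - r • 1)) fun x => (x, y))) ∧
    -- confluent function `Γ₁`
    ((Commute B B' → DiffX r (Γ1 A B B') ((-1) ^ r * poch A r)
        (Γ1 (A + r • 1) (B - r • 1) (B' + r • 1)) ((poch (1 - B) r)⁻¹ * poch B' r)) ∧
      (Commute B B' → DiffY r (Γ1 A B B') ((-1) ^ r)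
        (Γ1 A (B + r • 1) (B' - r • 1)) (poch B r * (poch (1 - B') r)⁻¹)) ∧
      (PowLeft r A (Γ1 A B B') (Γ1 (A + r • 1) B B') fun x => (x, y)) ∧
      (PowRight r B' (Γ1 A B B') (Γ1 A B (B' + r • 1)) fun x => (x, y / x)) ∧
      (Commute B B' → PowRight r B (Γ1 A B B') (Γ1 A (B + r • 1) B') fun y => (x / y, y))) ∧
    -- confluent function `Γ₂`
    ((DiffX r (Γ2 B B') ((-1) ^ r * (poch (1 - B) r)⁻¹)
        (Γ2 (B - r • 1) (B' + r • 1)) (poch B' r)) ∧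
      (DiffY r (Γ2 B B') ((-1) ^ r * poch B r) (Γ2 (B + r • 1) (B' - r • 1)) (poch (1 - B') r)⁻¹) ∧
      (PowRight r B' (Γ2 B B') (Γ2 B (B' + r • 1)) fun x => (x, y / x)) ∧
      (PowLeft r B (Γ2 B B') (Γ2 (B + r • 1) B') fun y => (x / y, y)) ∧
      (Commute B B' → PowRight r B (Γ2 B B') (Γ2 (B + r • 1) B') fun y => (x / y, y))) ∧
    -- confluent function `ℋ₁`
    ((Commute A B → DiffX r (ℋ1 A B C) (poch A r * poch B r)
        (ℋ1 (A + r • 1) (B + r • 1) (C + r • 1)) (poch C r)⁻¹) ∧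
      (Commute A B → DiffY r (ℋ1 A B C) ((-1) ^ r * (poch (1 - A) r)⁻¹ * poch B r)
        (ℋ1 (A - r • 1) (B + r • 1) C) 1) ∧
      (PowLeft r A (ℋ1 A B C) (ℋ1 (A + r • 1) B C) fun x => (x, y / x)) ∧
      (Commute A B → PowLeft r B (ℋ1 A B C) (ℋ1 A (B + r • 1) C) fun x => (x, y * x)) ∧
      (PowLower r C (ℋ1 A B C) (ℋ1 A B (C - r • 1)) fun x => (x, y))) ∧
    -- confluent function `ℋ₂`
    ((Commute A B → DiffX r (ℋ2 A B B' C) (poch A r * poch B r)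
        (ℋ2 (A + r • 1) (B + r • 1) B' (C + r • 1)) (poch C r)⁻¹) ∧
      (Commute B' C → DiffY r (ℋ2 A B B' C) ((-1) ^ r * (poch (1 - A) r)⁻¹)
        (ℋ2 (A - r • 1) B (B' + r • 1) C) (poch B' r)) ∧
      (PowLeft r A (ℋ2 A B B' C) (ℋ2 (A + r • 1) B B' C) fun x => (x, y / x)) ∧
      (Commute A B → PowLeft r B (ℋ2 A B B' C) (ℋ2 A (B + r • 1) B' C) fun x => (x, y)) ∧
      (Commute B' C → PowRight r B' (ℋ2 A B B' C) (ℋ2 A B (B' + r • 1) C) fun y => (x, y)) ∧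
      (PowLower r C (ℋ2 A B B' C) (ℋ2 A B B' (C - r • 1)) fun x => (x, y))) ∧
    -- confluent function `ℋ₃`
    ((Commute B C → DiffX r (ℋ3 A B C) (poch A r)
        (ℋ3 (A + r • 1) (B + r • 1) (C + r • 1)) (poch B r * (poch C r)⁻¹)) ∧
      (DiffY r (ℋ3 A B C) ((-1) ^ r * (poch (1 - A) r)⁻¹) (ℋ3 (A - r • 1) B C) 1) ∧
      (PowLeft r A (ℋ3 A B C) (ℋ3 (A + r • 1) B C) fun x => (x, y / x)) ∧
      (Commute B C → PowRight r B (ℋ3 A B C) (ℋ3 A (B + r • 1) C) fun x => (x, y)) ∧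
      (PowLower r C (ℋ3 A B C) (ℋ3 A B (C - r • 1)) fun x => (x, y))) ∧
    -- confluent function `ℋ₄`
    ((DiffX r (ℋ4 A B' C) (poch A r) (ℋ4 (A + r • 1) B' (C + r • 1)) (poch C r)⁻¹) ∧
      (Commute B' C → DiffY r (ℋ4 A B' C) ((-1) ^ r * (poch (1 - A) r)⁻¹)
        (ℋ4 (A - r • 1) (B' + r • 1) C) (poch B' r)) ∧
      (PowLeft r A (ℋ4 A B' C) (ℋ4 (A + r • 1) B' C) fun x => (x, y / x)) ∧
      (Commute B' C → PowRight r B' (ℋ4 A B' C) (ℋ4 A (B' + r • 1) C) fun y => (x, y)) ∧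
      (PowLower r C (ℋ4 A B' C) (ℋ4 A B' (C - r • 1)) fun x => (x, y))) ∧
    -- confluent function `ℋ₅`
    ((DiffX r (ℋ5 A C) (poch A r) (ℋ5 (A + r • 1) (C + r • 1)) (poch C r)⁻¹) ∧
      (DiffY r (ℋ5 A C) ((-1) ^ r * (poch (1 - A) r)⁻¹) (ℋ5 (A - r • 1) C) 1) ∧
      (PowLeft r A (ℋ5 A C) (ℋ5 (A + r • 1) C) fun x => (x, y / x)) ∧
      (PowLower r C (ℋ5 A C) (ℋ5 A (C - r • 1)) fun x => (x, y))) ∧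
    -- confluent function `ℋ₆`
    ((DiffX r (ℋ6 A C) (poch A (2 * r)) (ℋ6 (A + (2 * r) • 1) (C + r • 1)) (poch C r)⁻¹) ∧
      (DiffY r (ℋ6 A C) (poch A r) (ℋ6 (A + r • 1) (C + r • 1)) (poch C r)⁻¹) ∧
      (PowLeft r A (ℋ6 A C) (ℋ6 (A + r • 1) C) fun x => (x ^ 2, y * x)) ∧
      (PowLower r C (ℋ6 A C) (ℋ6 A (C - r • 1)) fun x => (x, x * y))) ∧
    -- confluent function `ℋ₇`
    ((Commute C C' → DiffX r (ℋ7 A C C') (poch A (2 * r))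
        (ℋ7 (A + (2 * r) • 1) (C + r • 1) C') (poch C r)⁻¹) ∧
      (DiffY r (ℋ7 A C C') (poch A r) (ℋ7 (A + r • 1) C (C' + r • 1)) (poch C' r)⁻¹) ∧
      (PowLeft r A (ℋ7 A C C') (ℋ7 (A + r • 1) C C') fun x => (x ^ 2, y * x)) ∧
      (Commute C C' → PowLower r C (ℋ7 A C C') (ℋ7 A (C - r • 1) C') fun x => (x, y)) ∧
      (PowLower r C' (ℋ7 A C C') (ℋ7 A C (C' - r • 1)) fun y => (x, y))) ∧
    -- confluent function `ℋ₈`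
    ((DiffX r (ℋ8 A B) ((-1) ^ r * poch A (2 * r))
        (ℋ8 (A + (2 * r) • 1) (B - r • 1)) (poch (1 - B) r)⁻¹) ∧
      (DiffY r (ℋ8 A B) ((-1) ^ r * (poch (1 - A) r)⁻¹) (ℋ8 (A - r • 1) (B + r • 1)) (poch B r)) ∧
      (PowLeft r A (ℋ8 A B) (ℋ8 (A + r • 1) B) fun x => (x ^ 2, y / x)) ∧
      (PowRight r B (ℋ8 A B) (ℋ8 A (B + r • 1)) fun y => (x / y, y))) ∧
    -- confluent function `ℋ₉`
    ((DiffX r (ℋ9 A B C) (poch A (2 * r)) (ℋ9 (A + (2 * r) • 1) B (C + r • 1)) (poch C r)⁻¹) ∧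
      (Commute B C → DiffY r (ℋ9 A B C) ((-1) ^ r * (poch (1 - A) r)⁻¹)
        (ℋ9 (A - r • 1) (B + r • 1) C) (poch B r)) ∧
      (PowLeft r A (ℋ9 A B C) (ℋ9 (A + r • 1) B C) fun x => (x ^ 2, y / x)) ∧
      (Commute B C → PowRight r B (ℋ9 A B C) (ℋ9 A (B + r • 1) C) fun y => (x, y)) ∧
      (PowLower r C (ℋ9 A B C) (ℋ9 A B (C - r • 1)) fun x => (x, y))) ∧
    -- confluent function `ℋ₁₀`
    ((DiffX r (ℋ10 A C) (poch A (2 * r)) (ℋ10 (A + (2 * r) • 1) (C + r • 1)) (poch C r)⁻¹) ∧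
      (DiffY r (ℋ10 A C) ((-1) ^ r * (poch (1 - A) r)⁻¹) (ℋ10 (A - r • 1) C) 1) ∧
      (PowLeft r A (ℋ10 A C) (ℋ10 (A + r • 1) C) fun x => (x ^ 2, y / x)) ∧
      (PowLower r C (ℋ10 A C) (ℋ10 A (C - r • 1)) fun x => (x, y))) ∧
    -- confluent function `ℋ₁₁`
    ((DiffX r (ℋ11 A B C C') (poch A r) (ℋ11 (A + r • 1) B C (C' + r • 1)) (poch C' r)⁻¹) ∧
      (Commute A B → Commute C C' → DiffY r (ℋ11 A B C C') ((-1) ^ r * (poch (1 - A) r)⁻¹ * poch B r)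
        (ℋ11 (A - r • 1) (B + r • 1) (C + r • 1) C') (poch C r)) ∧
      (PowLeft r A (ℋ11 A B C C') (ℋ11 (A + r • 1) B C C') fun x => (x, y / x)) ∧
      (Commute A B → PowLeft r B (ℋ11 A B C C') (ℋ11 A (B + r • 1) C C') fun y => (x, y)) ∧
      (PowLower r C' (ℋ11 A B C C') (ℋ11 A B C (C' - r • 1)) fun x => (x, y))) :=
  ⟨⟨G2.diffX, G2.diffY, G2.powLeft_A, G2.powLeft_A', G2.powRight_B', G2.powRight_B⟩,
    ⟨G3.diffX, G3.diffY, G3.powRight_A', G3.powLeft_A⟩,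
    ⟨H1.diffX, H1.diffY, H1.powLeft_A, H1.powLeft_B, H1.powRight_C, H1.powLower_C'⟩,
    ⟨H2.diffX, H2.diffY, H2.powLeft_A, H2.powLeft_B, H2.powRight_C, H2.powLower_C''⟩,
    ⟨H3.diffX, H3.diffY, H3.powLeft_A, H3.powRight_B, H3.powLower_C⟩,
    ⟨H4.diffX, H4.diffY, H4.powLeft_A, H4.powLeft_B, H4.powLower_C, H4.powLower_C'⟩,
    ⟨H5.diffX, H5.diffY, H5.powLeft_A, H5.powLeft_B, H5.powLower_C⟩,
    ⟨H6.diffX, H6.diffY, H6.powLeft_A, H6.powLeft_B, H6.powRight_C⟩,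
    ⟨H7.diffX, H7.diffY, H7.powLeft_A, H7.powLeft_B, H7.powRight_C, H7.powLower_C'⟩,
    ⟨Γ1.diffX, Γ1.diffY, Γ1.powLeft_A, Γ1.powRight_B', Γ1.powRight_B⟩,
    ⟨Γ2.diffX, Γ2.diffY, Γ2.powRight_B', Γ2.powLeft_B, Γ2.powRight_B⟩,
    ⟨ℋ1.diffX, ℋ1.diffY, ℋ1.powLeft_A, ℋ1.powLeft_B, ℋ1.powLower_C⟩,
    ⟨ℋ2.diffX, ℋ2.diffY, ℋ2.powLeft_A, ℋ2.powLeft_B, ℋ2.powRight_B', ℋ2.powLower_C⟩,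
    ⟨ℋ3.diffX, ℋ3.diffY, ℋ3.powLeft_A, ℋ3.powRight_B, ℋ3.powLower_C⟩,
    ⟨ℋ4.diffX, ℋ4.diffY, ℋ4.powLeft_A, ℋ4.powRight_B', ℋ4.powLower_C⟩,
    ⟨ℋ5.diffX, ℋ5.diffY, ℋ5.powLeft_A, ℋ5.powLower_C⟩,
    ⟨ℋ6.diffX, ℋ6.diffY, ℋ6.powLeft_A, ℋ6.powLower_C⟩,
    ⟨ℋ7.diffX, ℋ7.diffY, ℋ7.powLeft_A, ℋ7.powLower_C, ℋ7.powLower_C'⟩,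
    ⟨ℋ8.diffX, ℋ8.diffY, ℋ8.powLeft_A, ℋ8.powRight_B⟩,
    ⟨ℋ9.diffX, ℋ9.diffY, ℋ9.powLeft_A, ℋ9.powRight_B, ℋ9.powLower_C⟩,
    ⟨ℋ10.diffX, ℋ10.diffY, ℋ10.powLeft_A, ℋ10.powLower_C⟩,
    ⟨ℋ11.diffX, ℋ11.diffY, ℋ11.powLeft_A, ℋ11.powLeft_B, ℋ11.powLower_C'⟩⟩
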